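/- Let $\mathcal A$ be an essential (finite) arrangement of affine hyperplanes in $\mathbb R^\ell$, $\ell\ge 1$. Regard $\mathbb R^\ell$ as the complement of the hyperplane at infinity $\overline H_\infty$ in $\mathbb P^\ell_{\mathbb R}$, and write $\overline{(\cdot)}$ for closures in $\mathbb P^\ell_{\mathbb R}$. Let $F^0\subset F^1\subset\dots\subset F^\ell=\mathbb R^\ell$ be affine subspaces, $\dim F^k=k$, and $F^{-1}=\emptyset$. Assume that this flag is generic: $\dim(X\cap\overline{F^k})=\dim X+k-\ell$ for every intersection $X$ of members of $\overline{\mathcal A}=\{\overline H: H\in\mathcal A\}\cup\{\overline H_\infty\}$ (empty if the right-hand side is negative). Assume also that it is near to $\overline H_\infty$: for $k=1,\dots,\ell$, $F^{k-1}$ does not separate the $0$-dimensional edges $L_0(\mathcal A\cap F^k)$. Let $\operatorname{ch}^k(\mathcal A)$ be the set of chambers of $\mathcal A$ (connected components of $\mathbb R^\ell\smallsetminus\bigcup_{H\in\mathcal A}H$) which meet $F^k$ but not $F^{k-1}$, and let $\operatorname{bch}^{k}(\mathcal A)$ be the set of $C\in\operatorname{ch}^k(\mathcal A)$ for which $C\cap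 F^k$ is bounded. Let $C\in\operatorname{bch}^{\ell-1}(\mathcal A)$, let $X(C)$ be the projective subspace generated by $\overline C\cap\overline H_\infty$, and let $d=\dim X(C)$. A chamber $D$ is opposite to $C$ with respect to $\overline C\cap\overline H_\infty$ if, for every $p\in C$ and every point $p'$ of the relative interior (in $X(C)$) of $\overline C\cap\overline H_\infty$, the projective line through $p$ and $p'$, followed from $p$ inside $C$ to $p'$, continues beyond $p'$ in $D$. For $C\in\operatorname{ch}^{k}(\mathcal A)$ and $D\in\operatorname{ch}^{k+1}(\mathcal A)$, the degree $\deg(C,D)\in\mathbb Z$ is the degree of the Gauss map $U/|U|:\partial(\operatorname{cl}(C)\cap B)\to S^{k-1}$, where $\operatorname{cl}(C)$ is the closure in $\mathbb R^\ell$, $B\subset F^k$ is a ball containing $L_0(\mathcal A\cap F^k)$ in its interior, and $U$ is a continuous vector field on $F^k$ directed to $D$. The latter means: $U\ne0$ on $\partial\operatorname{cl}(C)\cap B$; at points of $\partial B\cap\operatorname{cl}(C)$, $U$ points to the inside of $B$; and at each point of each $H\cap F^k$, $H\in\mathcal A$, $U$ is transversal to $H$ and points to the side of $H$ containing $D$.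 (The source and target of the Gauss map are oriented as boundaries in $F^k$ for the same orientation; for $k=0$ the degree is $1$.) Then there is exactly one chamber $C^\vee$ opposite to $C$ with respect to $\overline C\cap\overline H_\infty$, it belongs to $\operatorname{ch}^\ell(\mathcal A)$, there are $B$ and $U$ as above (with $k=\ell-1$ and $D=C^\vee$), and for all of them the degree of the Gauss map is the same, namely $$\deg(C,C^\vee)=(-1)^{\ell-1-d}.$$ This number is also the index at the origin of the linear vector field $\sum_{i=1}^{d}x_i\,\partial_i-\sum_{i=d+1}^{\ell-1}x_i\,\partial_i$ on $\mathbb R^{\ell-1}$. -/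

import Mathlib

open Set Filter Topology MeasureTheory
open scoped LinearAlgebra.Projectivization ContDiff

noncomputable section

namespace Arrangement

/-! ### Affine arrangements, edges and chambers in `ℝ^ℓ` -/

/-- Real affine space `ℝ^ℓ`. -/
abbrev Space (ℓ : ℕ) : Type := EuclideanSpace ℝ (Fin ℓ)

/-- An affine hyperplane arrangement in `ℝ^ℓ`: a finite set of affine hyperplanes. -/
def IsArrangement {ℓ : ℕ} (A : Set (AffineSubspace ℝ (Space ℓ))) : Prop :=
  A.Finite ∧ ∀ H ∈ A, (H : Set (Space ℓ)).Nonempty ∧ Module.finrank ℝ H.direction + 1 = ℓ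

/-- `L_0(A ∩ F)`, as a set of points: the points that arise as the intersection of `F` with some
(possibly empty) family of hyperplanes of `A`.  For `F = ⊤` this is `L_0(A)`. -/
def pointEdges {ℓ : ℕ} (A : Set (AffineSubspace ℝ (Space ℓ))) (F : AffineSubspace ℝ (Space ℓ)) :
    Set (Space ℓ) :=
  {p | ∃ B ⊆ A, (F : Set (Space ℓ)) ∩ (⋂ H ∈ B, (H : Set (Space ℓ))) = {p}}

/-- `A` is essential: it has a `0`-dimensional edge. -/
def IsEssential {ℓ : ℕ} (A : Set (AffineSubspace ℝ (Space ℓ))) : Prop :=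
  (pointEdges A ⊤).Nonempty

/-- The complement of the union of all hyperplanes. -/
def compl {ℓ : ℕ} (A : Set (AffineSubspace ℝ (Space ℓ))) : Set (Space ℓ) :=
  {x | ∀ H ∈ A, x ∉ H}

/-- `ch(A)`: the connected components of the complement. -/
def chambers {ℓ : ℕ} (A : Set (AffineSubspace ℝ (Space ℓ))) : Set (Set (Space ℓ)) :=
  {C | ∃ x ∈ compl A, C = connectedComponentIn (compl A) x}

/-! ### Projective closures

`ℙ^ℓ` is the projectivization of `ℝ × ℝ^ℓ`, with `ℝ^ℓ` embedded by `x ↦ [1 : x]` and with the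
hyperplane at infinity `{[0 : v]}`.  A projective subspace of dimension `m` is the same thing as a
linear subspace of `ℝ × ℝ^ℓ` of dimension `m + 1` (the empty one corresponding to `0`). -/

/-- The linear subspace of `ℝ × ℝ^ℓ` which corresponds to the projective closure of an affine
subspace. -/
def homogenize {ℓ : ℕ} (X : AffineSubspace ℝ (Space ℓ)) : Submodule ℝ (ℝ × Space ℓ) :=
  Submodule.span ℝ {w | ∃ x ∈ X, w = ((1 : ℝ), x)}

/-- The hyperplane at infinity, as a linear subspace of `ℝ × ℝ^ℓ`. -/
def infinityHyperplane (ℓ : ℕ) : Submodule ℝ (ℝ × Space ℓ) :=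
  LinearMap.ker (LinearMap.fst ℝ ℝ (Space ℓ))

/-- The projective closure of the arrangement: the closures of the hyperplanes, together with the
hyperplane at infinity. -/
def projClosure {ℓ : ℕ} (A : Set (AffineSubspace ℝ (Space ℓ))) :
    Set (Submodule ℝ (ℝ × Space ℓ)) :=
  insert (infinityHyperplane ℓ) (homogenize '' A)

/-- The edges of the projective closure: all intersections of its members. -/
def projEdges {ℓ : ℕ} (A : Set (AffineSubspace ℝ (Space ℓ))) :
    Set (Submodule ℝ (ℝ × Space ℓ)) :=
  {X | ∃ B ⊆ projClosure A, X = sInf B}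

/-- The quotient topology on a projective space. -/
instance projectiveTopology {ℓ : ℕ} : TopologicalSpace (ℙ ℝ (ℝ × Space ℓ)) :=
  TopologicalSpace.coinduced
    (fun v : {v : ℝ × Space ℓ // v ≠ 0} => Projectivization.mk ℝ v.1 v.2) inferInstance

/-- The embedding `x ↦ [1 : x]` of `ℝ^ℓ` in `ℙ^ℓ`. -/
def toProj {ℓ : ℕ} (x : Space ℓ) : ℙ ℝ (ℝ × Space ℓ) :=
  Projectivization.mk ℝ ((1 : ℝ), x) (fun h => one_ne_zero (congrArg Prod.fst h))

/-- The point at infinity `[0 : v]`. -/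
def atInfinity {ℓ : ℕ} (v : Space ℓ) (hv : v ≠ 0) : ℙ ℝ (ℝ × Space ℓ) :=
  Projectivization.mk ℝ ((0 : ℝ), v) (fun h => hv (congrArg Prod.snd h))

/-- The intersection of the closure of `C` in `ℙ^ℓ` with the hyperplane at infinity. -/
def boundaryAtInfinity {ℓ : ℕ} (C : Set (Space ℓ)) : Set (ℙ ℝ (ℝ × Space ℓ)) :=
  {p | p ∈ closure (toProj '' C) ∧ ∃ (v : Space ℓ) (hv : v ≠ 0), p = atInfinity v hv}

/-- `X(C)`: the projective subspace generated by the boundary of `C` at infinity. -/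
def spanAtInfinity {ℓ : ℕ} (C : Set (Space ℓ)) : Projectivization.Subspace ℝ (ℝ × Space ℓ) :=
  Projectivization.Subspace.span (boundaryAtInfinity C)

/-- `HasProjDim X d`: the projective subspace `X` has (projective) dimension `d`. -/
def HasProjDim {ℓ : ℕ} (X : Projectivization.Subspace ℝ (ℝ × Space ℓ)) (d : ℕ) : Prop :=
  Module.finrank ℝ (Projectivization.Subspace.submodule X) = d + 1

/-- The relative interior of the boundary of `C` at infinity, inside the projective subspace `X(C)`
which it generates. -/
def relInteriorAtInfinity {ℓ : ℕ} (C : Set (Space ℓ)) : Set (ℙ ℝ (ℝ × Space ℓ)) :=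
  {p | p ∈ boundaryAtInfinity C ∧
    boundaryAtInfinity C ∈ 𝓝[(spanAtInfinity C : Set (ℙ ℝ (ℝ × Space ℓ)))] p}

/-- `D` is the chamber opposite to the unbounded chamber `C` with respect to the boundary of `C` at
infinity: if the ray from `p ∈ C` in direction `v` stays in `C` and runs into a point `[0 : v]` of
the relative interior of that boundary, then the projective line through `p` and `[0 : v]`
continues, on the other side of `[0 : v]`, in `D`. -/
def IsOpposite {ℓ : ℕ} (A : Set (AffineSubspace ℝ (Space ℓ))) (C D : Set (Space ℓ)) : Prop :=
  D ∈ chambers A ∧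
    ∀ p ∈ C, ∀ (v : Space ℓ) (hv : v ≠ 0), atInfinity v hv ∈ relInteriorAtInfinity C →
      (∀ t : ℝ, 0 ≤ t → p + t • v ∈ C) → ∀ᶠ t : ℝ in atTop, p - t • v ∈ D

/-! ### Generic flags near infinity -/

/-- The member `F^{k-1}` of a flag, with `F^{-1} = ∅`. -/
def flagPred {ℓ : ℕ} (F : ℕ → AffineSubspace ℝ (Space ℓ)) : ℕ → AffineSubspace ℝ (Space ℓ)
  | 0 => ⊥
  | k + 1 => F k

/-- A generic flag `F^0 ⊂ F^1 ⊂ ⋯ ⊂ F^ℓ = ℝ^ℓ` (only `F 0, …, F ℓ` matter): for every edge `X` of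
the projective closure of `A`, `dim (X ∩ F^k) = dim X + k - ℓ`, where a negative right-hand side
means that the intersection is empty.  In terms of linear dimensions, which are projective
dimensions plus one, this is the truncated subtraction below. -/
structure IsGenericFlag {ℓ : ℕ} (A : Set (AffineSubspace ℝ (Space ℓ)))
    (F : ℕ → AffineSubspace ℝ (Space ℓ)) : Prop where
  nonempty : ∀ k ≤ ℓ, (F k : Set (Space ℓ)).Nonempty
  finrank_direction : ∀ k ≤ ℓ, Module.finrank ℝ (F k).direction = k
  le_succ : ∀ k < ℓ, F k ≤ F (k + 1)
  generic : ∀ k ≤ ℓ, ∀ X ∈ projEdges A,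
    Module.finrank ℝ (X ⊓ homogenize (F k) : Submodule ℝ (ℝ × Space ℓ)) =
      Module.finrank ℝ X + k - ℓ

/-- The flag is near to the hyperplane at infinity: `F^{k-1}` does not separate the points of
`L_0(A ∩ F^k)`, for `k = 1, …, ℓ`. -/
def IsNearInfinity {ℓ : ℕ} (A : Set (AffineSubspace ℝ (Space ℓ)))
    (F : ℕ → AffineSubspace ℝ (Space ℓ)) : Prop :=
  ∀ k < ℓ, ∀ p ∈ pointEdges A (F (k + 1)), ∀ q ∈ pointEdges A (F (k + 1)), ¬ (F k).SOppSide p q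

/-- `ch^k(A)`: the chambers which meet `F^k` but not `F^{k-1}`. -/
def ch {ℓ : ℕ} (A : Set (AffineSubspace ℝ (Space ℓ))) (F : ℕ → AffineSubspace ℝ (Space ℓ))
    (k : ℕ) : Set (Set (Space ℓ)) :=
  {C | C ∈ chambers A ∧ (C ∩ (F k : Set (Space ℓ))).Nonempty ∧
    C ∩ (flagPred F k : Set (Space ℓ)) = ∅}

/-- `bch^k(A)`: the members `C` of `ch^k(A)` such that `C ∩ F^k` is bounded. -/
def bch {ℓ : ℕ} (A : Set (AffineSubspace ℝ (Space ℓ))) (F : ℕ → AffineSubspace ℝ (Space ℓ))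
    (k : ℕ) : Set (Set (Space ℓ)) :=
  {C | C ∈ ch A F k ∧ Bornology.IsBounded (C ∩ (F k : Set (Space ℓ)))}

/-! ### Degrees -/

/-- The Gauss map `U / |U|` of a vector field. -/
def gaussMap {V : Type*} [NormedAddCommGroup V] [NormedSpace ℝ V] (U : V → V) (x : V) : V :=
  ‖U x‖⁻¹ • U x

/-- `HasMappingDegree K g n`: `K` is compact, `g` is a continuous map from the boundary `∂K` to the
unit sphere of `V`, and `n` is its topological (Brouwer) degree, where `∂K` is oriented as the
boundary of `K` and the sphere as the boundary of the unit ball, both for the same orientation of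
`V`.

The degree of a continuous map is that of all smooth maps `W` sufficiently close to it.  For smooth
`W : V → V` with no zeros on `∂K` it is given by de Rham theory: if the top-degree form
`ω = φ(y) dy` is supported in a ball around `0` which `W` does not meet on `∂K`, then
`∫_K W^* ω = n ∫_V ω`, where `W^* ω = φ(W x) det(DW(x)) dx`. -/
def HasMappingDegree {V : Type*} [NormedAddCommGroup V] [InnerProductSpace ℝ V]
    [FiniteDimensional ℝ V] [MeasurableSpace V] [BorelSpace V]
    (K : Set V) (g : V → V) (n : ℤ) : Prop :=
  IsCompact K ∧ ContinuousOn g (frontier K) ∧ (∀ x ∈ frontier K, ‖g x‖ = 1) ∧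
    ∃ δ : ℝ, 0 < δ ∧ ∀ W : V → V, ContDiff ℝ ∞ W → (∀ x ∈ frontier K, ‖W x - g x‖ < δ) →
      ∀ r : ℝ, 0 < r → (∀ x ∈ frontier K, r ≤ ‖W x‖) →
        ∀ φ : V → ℝ, ContDiff ℝ ∞ φ → tsupport φ ⊆ Metric.ball 0 r →
          ∫ x in K, φ (W x) * (fderiv ℝ W x).det = n * ∫ y, φ y

/-- The degree is well defined: at most one integer is the degree of `g`. -/
theorem HasMappingDegree.unique {V : Type*} [NormedAddCommGroup V] [InnerProductSpace ℝ V]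
    [FiniteDimensional ℝ V] [MeasurableSpace V] [BorelSpace V]
    {K : Set V} {g : V → V} {m n : ℤ} (hm : HasMappingDegree K g m)
    (hn : HasMappingDegree K g n) : m = n := by
  obtain ⟨-, hg, hg1, δ₁, hδ₁, h₁⟩ := hm
  obtain ⟨-, -, -, δ₂, hδ₂, h₂⟩ := hn
  have hδ : 0 < min (min δ₁ δ₂) (1 / 2) := by positivity
  set δ := min (min δ₁ δ₂) (1 / 2) with hδdef
  have hd1 : δ ≤ δ₁ := (min_le_left _ _).trans (min_le_left _ _)
  have hd2 : δ ≤ δ₂ := (min_le_left _ _).trans (min_le_right _ _)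
  have hd3 : δ ≤ 1 / 2 := min_le_right _ _
  obtain ⟨W, hW⟩ := exists_contMDiffMap_forall_mem_convex_of_local_const (n := (⊤ : ℕ∞))
    (modelWithCornersSelf ℝ V) (F := V) (t := fun x => {y | x ∈ frontier K → ‖y - g x‖ < δ})
    (by
      intro x
      by_cases hx : x ∈ frontier K
      · have : {y | x ∈ frontier K → ‖y - g x‖ < δ} = Metric.ball (g x) δ := by
          ext y; simp [hx, dist_eq_norm]
        rw [this]
        exact convex_ball _ _
      · have : {y | x ∈ frontier K → ‖y - g x‖ < δ} = Set.univ := by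
          ext y; simp [hx]
        rw [this]
        exact convex_univ)
    (by
      intro x
      refine ⟨g x, ?_⟩
      by_cases hx : x ∈ frontier K
      · have := Metric.tendsto_nhds.1 (hg x hx) δ hδ
        rw [eventually_nhdsWithin_iff] at this
        filter_upwards [this] with y hy hyK
        have := hy hyK
        rwa [dist_comm, dist_eq_norm] at this
      · filter_upwards [isClosed_frontier.isOpen_compl.mem_nhds hx] with y hy hyK
        exact absurd hyK hy)
  have hWs : ContDiff ℝ ∞ (W : V → V) := W.contMDiff.contDiff
  have hr : ∀ x ∈ frontier K, (1 / 2 : ℝ) ≤ ‖W x‖ := by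
    intro x hx
    have h3 : ‖W x - g x‖ < δ := hW x hx
    have h4 := norm_sub_norm_le (g x) (W x)
    rw [hg1 x hx, norm_sub_rev] at h4
    linarith
  let φ : ContDiffBump (0 : V) := ⟨1 / 8, 1 / 4, by norm_num, by norm_num⟩
  have hφ : tsupport φ ⊆ Metric.ball 0 (1 / 2) := by
    rw [φ.tsupport_eq]
    exact Metric.closedBall_subset_ball (by norm_num [φ])
  have e₁ := h₁ W hWs (fun x hx => (hW x hx).trans_le hd1) (1 / 2) (by norm_num) hr φ
    φ.contDiff hφ
  have e₂ := h₂ W hWs (fun x hx => (hW x hx).trans_le hd2) (1 / 2) (by norm_num) hr φ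
    φ.contDiff hφ
  have hpos : 0 < ∫ y, φ y := φ.integral_pos
  have := mul_right_cancel₀ hpos.ne' (e₁.symm.trans e₂)
  exact_mod_cast this

/-- The set `closure C ∩ B`, where `B` is the ball in `F` of centre `c ∈ F` and radius `R`.  Points
`x` of `F` are written `x = c + v` with `v` in the direction of `F`. -/
def cell {ℓ : ℕ} (F : AffineSubspace ℝ (Space ℓ)) (C : Set (Space ℓ)) (c : Space ℓ) (R : ℝ) :
    Set F.direction :=
  {v | c + (v : Space ℓ) ∈ closure C ∧ ‖v‖ ≤ R}

/-- `(c, R, U)` are admissible for computing the degree between `C` and `D`: the ball `B` in `F` of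
centre `c ∈ F` and radius `R` contains `L_0(A ∩ F)` in its interior, and `U` is a (continuous)
vector field on `F` which is directed to the chamber `D`.  The vector field is written in the
coordinate `v = x - c` of `x ∈ F`. -/
structure IsDirected {ℓ : ℕ} (A : Set (AffineSubspace ℝ (Space ℓ)))
    (F : AffineSubspace ℝ (Space ℓ)) (C D : Set (Space ℓ)) (c : Space ℓ) (R : ℝ)
    (U : F.direction → F.direction) : Prop where
  center_mem : c ∈ F
  pointEdges_subset : pointEdges A F ⊆ Metric.ball c R
  continuous : Continuous U
  /-- `U` does not vanish on the part of the boundary of `C` inside `B`. -/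
  ne_zero : ∀ v : F.direction, c + (v : Space ℓ) ∈ frontier (closure C) → ‖v‖ ≤ R → U v ≠ 0
  /-- On the boundary of `B`, at points of the closure of `C`, `U` points to the inside of `B`. -/
  inward : ∀ v : F.direction, ‖v‖ = R → c + (v : Space ℓ) ∈ closure C → inner ℝ (U v) v < 0
  /-- At the points of a hyperplane `H`, `U` is transversal to `H` and points to the side of `H` in
  which `D` lies. -/
  directed : ∀ H ∈ A, ∀ v : F.direction, c + (v : Space ℓ) ∈ H → ∀ y ∈ D,
    H.SSameSide (c + (v : Space ℓ) + (U v : Space ℓ)) y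

/-- `IsDegree A F C D n`: `deg(C, D) = n`, computed on the member `F = F^k` of the flag, for
`C ∈ ch^k(A)` and `D ∈ ch^{k+1}(A)`.  There is an admissible ball with a vector field directed to
`D`, and for all of these the Gauss map on the boundary of `closure C ∩ B` has degree `n`. -/
def IsDegree {ℓ : ℕ} (A : Set (AffineSubspace ℝ (Space ℓ))) (F : AffineSubspace ℝ (Space ℓ))
    (C D : Set (Space ℓ)) (n : ℤ) : Prop :=
  (∃ (c : Space ℓ) (R : ℝ) (U : F.direction → F.direction), IsDirected A F C D c R U) ∧
    ∀ (c : Space ℓ) (R : ℝ) (U : F.direction → F.direction), IsDirected A F C D c R U →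
      HasMappingDegree (cell F C c R) (gaussMap U) n

/-- The linear vector field `∑_{i ≤ d} x_i ∂_i - ∑_{i > d} x_i ∂_i` on `ℝ^m`. -/
def linearField (m d : ℕ) (x : Space m) : Space m :=
  WithLp.toLp 2 (fun i : Fin m => if (i : ℕ) < d then x i else -x i)

/-- `n` is the index at the origin of a vector field on `ℝ^m` whose only zero is the origin: the
degree of its Gauss map on every sphere around the origin. -/
def HasIndexAtOrigin {m : ℕ} (U : Space m → Space m) (n : ℤ) : Prop :=
  ∀ ρ : ℝ, 0 < ρ → HasMappingDegree (Metric.closedBall (0 : Space m) ρ) (gaussMap U) n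

end Arrangement

end

/-! Write F = F^{ℓ-1} = {h = 0} and C = {α_H > 0 for all H}. Genericity and nearness to infinity
allow the sign of h to be chosen so that h < 0 at all vertices of the arrangement. On a pointed
polyhedron a linear function either increases along a ray or is dominated by its value at a vertex.
Hence at every point with h ≥ 0 the closed face of that point has a recession direction along which
h increases (`exists_face_ray`). Since C ∩ F is bounded, h then increases along every nonzero
recession direction of C (`linear_pos_of_recession`).

Call H parallel if α_H is constant along all recession directions of C. The recession cone spans the
common kernel E of the parallel linear parts, and X(C) is the projectivization of E. A line that
leaves C through the relative interior at infinity comes back with exactly the non-parallel signs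
reversed; this determines the opposite chamber (`isOpposite_iff`). If it met F, a face ray u there
would lie in E and -u would be a recession direction of C along which h decreases, which is
impossible (`oppositeChamber_disjoint`).

On the boundary of the polytope cl(C) ∩ F a field directed to the opposite chamber points inward at
parallel walls and outward at the others. It is compared with G(x) = o - x + e(x), where o ∈ C ∩ F
and e takes values in E and pushes strongly outward at non-parallel walls: the two never point in
opposite directions. In turn G is linearly homotopic without zeros to the reflection in E ∩ dir F
centred at o. A zero in between would force x - o ∈ E, hence a non-parallel wall at x, where both
fields point outward. The reflection has determinant (-1) to the codimension of E ∩ dir F in dir F,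
and genericity makes dim (E ∩ dir F) = d (`finrank_direction_inf`).

Degrees are integrals of pulled back top forms. Their homotopy invariance holds because the
derivative in the homotopy parameter is a divergence of a field vanishing near the frontier
(`setIntegral_pullback_eq_of_homotopy`); no regularity of the boundary is needed. -/

namespace Arrangement

/-! ### Cofactor fields and their divergence. -/

section VolumeForm

variable {ι : Type*} [Fintype ι] [DecidableEq ι] {V : Type*} [NormedAddCommGroup V]
  [NormedSpace ℝ V] [FiniteDimensional ℝ V]

/-- The determinant with respect to a basis, as a continuous multilinear map. -/
noncomputable def volForm (b : Module.Basis ι ℝ V) :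
    ContinuousMultilinearMap ℝ (fun _ : ι => V) ℝ where
  toMultilinearMap := b.det.toMultilinearMap
  cont := by
    change Continuous fun v : ι → V => b.det v
    simp only [Module.Basis.det_apply]
    refine Continuous.matrix_det (continuous_matrix fun i j => ?_)
    have h : Continuous (b.coord i) := LinearMap.continuous_of_finiteDimensional _
    exact h.comp (continuous_apply j)

theorem volForm_apply (b : Module.Basis ι ℝ V) (v : ι → V) : volForm b v = b.det v := rfl

theorem volForm_map_basis (b : Module.Basis ι ℝ V) (L : V →L[ℝ] V) :
    volForm b (fun k => L (b k)) = L.det := by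
  have h := b.det_comp (L : V →ₗ[ℝ] V) b
  rw [b.det_self, mul_one] at h
  exact h

/-- Cramer's rule for the matrix with columns `M`. -/
theorem sum_volForm_update_smul (b : Module.Basis ι ℝ V) (M : ι → V) (ψ : V) :
    ∑ j, volForm b (Function.update M j ψ) • M j = volForm b M • ψ := by
  apply b.repr.injective
  ext i
  have h := congrFun (Matrix.mulVec_cramer (b.toMatrix M) (b.repr ψ)) i
  simp only [map_sum, map_smul, Finsupp.coe_finsetSum, Finset.sum_apply, Finsupp.smul_apply,
    smul_eq_mul, volForm_apply, Module.Basis.det_apply, b.toMatrix_update]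
  simp only [Matrix.mulVec, dotProduct, Matrix.cramer_apply, Module.Basis.toMatrix_apply,
    Pi.smul_apply, smul_eq_mul] at h
  rw [← h]
  exact Finset.sum_congr rfl fun j _ => mul_comm _ _

/-- Exchanging columns j and k reverses the sign of a term, while the symmetry of `S` makes the
result the term with j and k interchanged. With second derivatives for `S`, this is why cofactor
matrices are divergence free. -/
theorem sum_sum_volForm_update_eq_zero (b : Module.Basis ι ℝ V) (M : ι → V) (ψ : V)
    (S : ι → ι → V) (hS : ∀ j k, S j k = S k j) :
    ∑ j, ∑ k, (if k = j then 0 else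
      volForm b (Function.update (Function.update M j ψ) k (S j k))) = 0 := by
  have key : ∀ j k, (if k = j then 0 else
      volForm b (Function.update (Function.update M j ψ) k (S j k))) =
      -(if j = k then 0 else
      volForm b (Function.update (Function.update M k ψ) j (S k j))) := by
    intro j k
    rcases eq_or_ne k j with rfl | h
    · simp
    · rw [if_neg h, if_neg h.symm, volForm_apply, volForm_apply,
        ← b.det.map_swap _ h]
      congr 1
      ext i
      rcases eq_or_ne i k with rfl | hik
      · simp [hS j i]
      rcases eq_or_ne i j with rfl | hij
      · simp [hik, hik.symm]
      · simp [Equiv.swap_apply_of_ne_of_ne hik hij, hij, hik]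
  have h2 : ∑ j, ∑ k, (if k = j then 0 else
      volForm b (Function.update (Function.update M j ψ) k (S j k))) =
      -∑ j, ∑ k, (if k = j then 0 else
      volForm b (Function.update (Function.update M j ψ) k (S j k))) := by
    conv_rhs => rw [Finset.sum_comm]
    simp only [← Finset.sum_neg_distrib]
    exact Finset.sum_congr rfl fun j _ => Finset.sum_congr rfl fun k _ => key j k
  linarith

/-- The components of the vector field `φ(W) adj(DW) ψ`. -/
noncomputable def cofactorField (b : Module.Basis ι ℝ V) (φ : V → ℝ) (W ψ : V → V) (j : ι)
    (x : V) : ℝ :=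
  φ (W x) * volForm b (Function.update (fun k => fderiv ℝ W x (b k)) j (ψ x))

theorem contDiff_cofactorField (b : Module.Basis ι ℝ V) {φ : V → ℝ} {W ψ : V → V}
    (hφ : ContDiff ℝ ∞ φ) (hW : ContDiff ℝ ∞ W) (hψ : ContDiff ℝ ∞ ψ) (j : ι) :
    ContDiff ℝ 1 (cofactorField b φ W ψ j) := by
  have h1 : ContDiff ℝ 1 fun x => φ (W x) := (hφ.comp hW).of_le (by norm_num)
  have h2 : ContDiff ℝ 1 fun x => Function.update (fun k => fderiv ℝ W x (b k)) j (ψ x) := by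
    rw [contDiff_pi]
    intro k
    rcases eq_or_ne k j with rfl | h
    · simpa using hψ.of_le (by norm_num)
    · simpa [h] using (hW.fderiv_right (m := 1) (by norm_cast)).clm_apply contDiff_const
  exact h1.mul ((volForm b).contDiff.comp h2)

/-- By the product rule, the derivative of φ contributes its first term through Cramer's rule, the
column ψ contributes the last term, and the second derivatives of W cancel in pairs. The right-hand
side is the derivative of φ(W) det(DW) when W moves in the direction ψ. -/
theorem sum_fderiv_cofactorField (b : Module.Basis ι ℝ V) {φ : V → ℝ} {W ψ : V → V}
    (hφ : ContDiff ℝ ∞ φ) (hW : ContDiff ℝ ∞ W) (hψ : ContDiff ℝ ∞ ψ) (x : V) :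
    ∑ j, fderiv ℝ (cofactorField b φ W ψ j) x (b j) =
      fderiv ℝ φ (W x) (ψ x) * volForm b (fun k => fderiv ℝ W x (b k)) +
        φ (W x) * ∑ j, volForm b
          (Function.update (fun k => fderiv ℝ W x (b k)) j (fderiv ℝ ψ x (b j))) := by
  set M : ι → V := fun k => fderiv ℝ W x (b k) with hM
  have hW1 : HasFDerivAt W (fderiv ℝ W x) x :=
    (hW.differentiable (by simp)).differentiableAt.hasFDerivAt
  have hψ1 : HasFDerivAt ψ (fderiv ℝ ψ x) x :=
    (hψ.differentiable (by simp)).differentiableAt.hasFDerivAt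
  have hφ1 : HasFDerivAt φ (fderiv ℝ φ (W x)) (W x) :=
    (hφ.differentiable (by simp)).differentiableAt.hasFDerivAt
  have hW2 : HasFDerivAt (fderiv ℝ W) (fderiv ℝ (fderiv ℝ W) x) x :=
    ((hW.fderiv_right (m := 1) (by norm_cast)).differentiable
      (by simp)).differentiableAt.hasFDerivAt
  have hsymm : ∀ v w, fderiv ℝ (fderiv ℝ W) x v w = fderiv ℝ (fderiv ℝ W) x w v := by
    have : IsSymmSndFDerivAt ℝ W x := hW.contDiffAt.isSymmSndFDerivAt (by
      rw [minSmoothness_of_isRCLikeNormedField]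
      exact WithTop.coe_le_coe.2 le_top)
    exact fun v w => this v w
  have hj : ∀ j, fderiv ℝ (cofactorField b φ W ψ j) x (b j) =
      fderiv ℝ φ (W x) (M j) * volForm b (Function.update M j (ψ x)) +
      (φ (W x) * volForm b (Function.update M j (fderiv ℝ ψ x (b j))) +
      φ (W x) * ∑ k, (if k = j then 0 else volForm b (Function.update (Function.update M j (ψ x)) k
        (fderiv ℝ (fderiv ℝ W) x (b j) (b k))))) := by
    intro j
    let g : ι → V → V := fun k y => Function.update (fun k => fderiv ℝ W y (b k)) j (ψ y) k
    let g' : ι → V →L[ℝ] V := fun k => if k = j then fderiv ℝ ψ x else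
      (fderiv ℝ (fderiv ℝ W) x).flip (b k)
    have hg : ∀ k, HasFDerivAt (g k) (g' k) x := by
      intro k
      rcases eq_or_ne k j with rfl | h
      · simpa [g, g'] using hψ1
      · have := hW2.clm_apply (hasFDerivAt_const (b k) x)
        simp only [g, g', h, if_false, Function.update_of_ne, ne_eq, not_false_eq_true]
        convert! this using 1
        ext v
        simp
    have hv := HasFDerivAt.multilinear_comp (f := volForm b) hg
    have hp := (hφ1.comp x hW1).mul hv
    have hd : HasFDerivAt (cofactorField b φ W ψ j) _ x := hp
    rw [hd.fderiv]
    have hg0 : (fun k => g k x) = Function.update M j (ψ x) := rfl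
    simp only [add_apply, smul_apply, smul_eq_mul,
      ContinuousLinearMap.comp_apply, sum_apply, Function.comp_apply, hg0,
      ContinuousMultilinearMap.toContinuousLinearMap_apply]
    rw [← Finset.add_sum_erase _ _ (Finset.mem_univ j)]
    rw [← Finset.add_sum_erase Finset.univ (fun k => if k = j then (0 : ℝ) else _)
      (Finset.mem_univ j)]
    have h1 : ∑ k ∈ Finset.univ.erase j, volForm b (Function.update (Function.update M j (ψ x)) k
        (g' k (b j))) = ∑ k ∈ Finset.univ.erase j, (if k = j then 0 else
          volForm b (Function.update (Function.update M j (ψ x)) k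
        (fderiv ℝ (fderiv ℝ W) x (b j) (b k)))) := by
      refine Finset.sum_congr rfl fun k hk => ?_
      have hk := (Finset.mem_erase.1 hk).1
      simp [g', hk]
    rw [h1]
    simp only [Function.update_idem, g', if_true, zero_add]
    simp only [hM]
    ring
  simp only [hj, Finset.sum_add_distrib, ← Finset.mul_sum]
  rw [sum_sum_volForm_update_eq_zero b M (ψ x) (fun j k => fderiv ℝ (fderiv ℝ W) x (b j) (b k))
    (fun j k => hsymm _ _)]
  have := congrArg (fderiv ℝ φ (W x)) (sum_volForm_update_smul b M (ψ x))
  simp only [map_sum, map_smul, smul_eq_mul] at this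
  rw [mul_zero, add_zero]
  congr 1
  rw [mul_comm, ← this]
  exact Finset.sum_congr rfl fun j _ => mul_comm _ _

end VolumeForm

/-! ### A divergence theorem without boundary regularity. -/

section Integral

variable {V : Type*} [NormedAddCommGroup V] [NormedSpace ℝ V] [FiniteDimensional ℝ V]
  [MeasurableSpace V] [BorelSpace V] {μ : Measure V} [μ.IsAddHaarMeasure]

/-- Because G vanishes near the frontier, its extension by zero outside K is C¹ with compact
support. -/
theorem setIntegral_fderiv_eq_zero {K : Set V} (hK : IsCompact K) {G : V → ℝ}
    (hG : ContDiff ℝ 1 G) (hG0 : ∀ x ∈ frontier K, G =ᶠ[𝓝 x] 0) (v : V) :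
    ∫ x in K, fderiv ℝ G x v ∂μ = 0 := by
  have hd0 : ∀ x ∈ frontier K, fderiv ℝ G x = 0 := fun x hx => by
    rw [(hG0 x hx).fderiv_eq]; simp
  have hder : ∀ x, HasFDerivAt (K.indicator G) (K.indicator (fderiv ℝ G) x) x := by
    intro x
    by_cases hx : x ∈ frontier K
    · have : K.indicator G =ᶠ[𝓝 x] fun _ => 0 := by
        filter_upwards [hG0 x hx] with y hy
        simp [hy]
      have h0 : K.indicator (fderiv ℝ G) x = 0 := by simp [hd0 x hx]
      rw [h0]
      exact (hasFDerivAt_const (0 : ℝ) x).congr_of_eventuallyEq this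
    by_cases hxK : x ∈ K
    · have hi : K ∈ 𝓝 x := by
        by_contra h
        exact hx ⟨subset_closure hxK, fun h' => h (mem_interior_iff_mem_nhds.1 h')⟩
      rw [Set.indicator_of_mem hxK]
      refine ((hG.differentiable (by simp)).differentiableAt.hasFDerivAt).congr_of_eventuallyEq ?_
      filter_upwards [hi] with y hy
      simp [hy]
    · rw [Set.indicator_of_notMem hxK]
      refine (hasFDerivAt_const (0 : ℝ) x).congr_of_eventuallyEq ?_
      filter_upwards [hK.isClosed.isOpen_compl.mem_nhds hxK] with y hy
      exact Set.indicator_of_notMem hy _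
  have hc0 : Continuous (K.indicator G) :=
    continuous_iff_continuousAt.2 fun x => (hder x).continuousAt
  have hc1 : Continuous (K.indicator (fderiv ℝ G)) :=
    continuous_indicator hd0 (hG.continuous_fderiv (by simp)).continuousOn
  have hs0 : HasCompactSupport (K.indicator G) :=
    HasCompactSupport.intro hK fun x hx => Set.indicator_of_notMem hx _
  have hc1v : Continuous (fun x => K.indicator (fderiv ℝ G) x v) := hc1.clm_apply continuous_const
  have hs1 : HasCompactSupport (fun x => K.indicator (fderiv ℝ G) x v) :=
    HasCompactSupport.intro hK fun x hx => by simp [hx]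
  have hf : ∀ x, fderiv ℝ (K.indicator G) x v = K.indicator (fderiv ℝ G) x v := fun x => by
    rw [(hder x).fderiv]
  -- Integration by parts against the constant function 1.
  have := integral_mul_fderiv_eq_neg_fderiv_mul_of_integrable (μ := μ) (f := fun _ : V => (1 : ℝ))
    (g := K.indicator G) (v := v) (by simp)
    (by simpa [hf] using hc1v.integrable_of_hasCompactSupport hs1)
    (by simpa using hc0.integrable_of_hasCompactSupport hs0)
    (fun x _ => differentiableAt_const _) (fun x _ => (hder x).differentiableAt)
  simp only [one_mul, hf] at this
  rw [← integral_indicator hK.measurableSet]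
  convert! this using 1
  · congr 1
    ext x
    by_cases h : x ∈ K <;> simp [h]
  · simp

end Integral

/-! ### Homotopy invariance of the integral of a pulled back form. -/

section Homotopy

theorem exists_mem_frontier_segment {V : Type*} [NormedAddCommGroup V] [NormedSpace ℝ V]
    {K : Set V} {o x : V} (ho : o ∈ interior K) (hx : x ∉ K) :
    ∃ t ∈ Icc (0 : ℝ) 1, o + t • (x - o) ∈ frontier K := by
  have hc : IsPreconnected (segment ℝ o x) := (convex_segment o x).isPreconnected
  obtain ⟨y, hy, hyK⟩ : ∃ y ∈ segment ℝ o x, y ∈ frontier K := by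
    by_contra! h
    obtain ⟨y, -, hy, hyK⟩ := hc (interior K) (closure K)ᶜ isOpen_interior
      isClosed_closure.isOpen_compl
      (fun y hy => by
        by_contra hy'
        rw [mem_union, not_or, mem_compl_iff, not_not] at hy'
        exact h y hy ⟨hy'.2, hy'.1⟩)
      ⟨o, left_mem_segment ℝ o x, ho⟩
      ⟨x, right_mem_segment ℝ o x, fun hxc => h x (right_mem_segment ℝ o x)
        ⟨hxc, fun hxi => hx (interior_subset hxi)⟩⟩
    exact hyK (subset_closure (interior_subset hy))
  rw [segment_eq_image'] at hy
  obtain ⟨t, ht, rfl⟩ := hy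
  exact ⟨t, ht, hyK⟩

variable {V : Type*} [NormedAddCommGroup V] [NormedSpace ℝ V] [FiniteDimensional ℝ V]
  [MeasurableSpace V] [BorelSpace V] {μ : Measure V} [μ.IsAddHaarMeasure]

theorem setIntegral_deriv_pullback_eq_zero {ι : Type*} [Fintype ι] [DecidableEq ι]
    (b : Module.Basis ι ℝ V) {K : Set V} (hK : IsCompact K) {φ : V → ℝ}
    {W ψ : V → V} (hφ : ContDiff ℝ ∞ φ) (hW : ContDiff ℝ ∞ W) (hψ : ContDiff ℝ ∞ ψ)
    (h0 : ∀ x ∈ frontier K, W x ∉ tsupport φ) :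
    ∫ x in K, (fderiv ℝ φ (W x) (ψ x) * volForm b (fun k => fderiv ℝ W x (b k)) +
        φ (W x) * ∑ j, volForm b
          (Function.update (fun k => fderiv ℝ W x (b k)) j (fderiv ℝ ψ x (b j)))) ∂μ = 0 := by
  simp only [← sum_fderiv_cofactorField b hφ hW hψ]
  have hc := contDiff_cofactorField b hφ hW hψ
  rw [integral_finsetSum]
  · refine Finset.sum_eq_zero fun j _ => setIntegral_fderiv_eq_zero hK (hc j) ?_ _
    intro x hx
    have : ∀ᶠ y in 𝓝 x, W y ∉ tsupport φ :=
      hW.continuous.continuousAt.eventually ((isClosed_tsupport φ).isOpen_compl.mem_nhds (h0 x hx))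
    filter_upwards [this] with y hy
    simp [cofactorField, image_eq_zero_of_notMem_tsupport hy]
  · intro j _
    exact ((((hc j).continuous_fderiv (by simp)).clm_apply continuous_const).continuousOn).integrableOn_compact
      hK

/-- For each x, integrate the derivative in s of φ(W_s) det(DW_s) over [0, 1]. After exchanging the
integrals, the integral over K vanishes for every s, since the integrand is a divergence. -/
theorem setIntegral_pullback_eq_of_homotopy {K : Set V} (hK : IsCompact K) {φ : V → ℝ}
    {W₀ W₁ : V → V} (hφ : ContDiff ℝ ∞ φ) (hW₀ : ContDiff ℝ ∞ W₀) (hW₁ : ContDiff ℝ ∞ W₁)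
    (h0 : ∀ x ∈ frontier K, ∀ s ∈ Icc (0 : ℝ) 1, W₀ x + s • (W₁ x - W₀ x) ∉ tsupport φ) :
    ∫ x in K, φ (W₀ x) * (fderiv ℝ W₀ x).det ∂μ = ∫ x in K, φ (W₁ x) * (fderiv ℝ W₁ x).det ∂μ := by
  classical
  let b := Module.finBasis ℝ V
  set ψ : V → V := fun x => W₁ x - W₀ x with hψdef
  have hψ : ContDiff ℝ ∞ ψ := hW₁.sub hW₀
  let W : ℝ → V → V := fun s x => W₀ x + s • ψ x
  have hW : ∀ s, ContDiff ℝ ∞ (W s) := fun s => hW₀.add (contDiff_const.smul hψ)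
  have dW₀ : Differentiable ℝ W₀ := hW₀.differentiable (by simp)
  have dψ : Differentiable ℝ ψ := hψ.differentiable (by simp)
  have hDW : ∀ s x, fderiv ℝ (W s) x = fderiv ℝ W₀ x + s • fderiv ℝ ψ x := by
    intro s x
    exact ((dW₀ x).hasFDerivAt.add ((dψ x).hasFDerivAt.const_smul s)).fderiv
  have c0 : Continuous (fderiv ℝ W₀) := hW₀.continuous_fderiv (by simp)
  have cψ : Continuous (fderiv ℝ ψ) := hψ.continuous_fderiv (by simp)
  have cφ : Continuous (fderiv ℝ φ) := hφ.continuous_fderiv (by simp)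
  have dφ : Differentiable ℝ φ := hφ.differentiable (by simp)
  let M : V → ℝ → Fin (Module.finrank ℝ V) → V := fun x s k =>
    fderiv ℝ W₀ x (b k) + s • fderiv ℝ ψ x (b k)
  have hM : ∀ s x, (fun k => fderiv ℝ (W s) x (b k)) = M x s := by
    intro s x; ext k; simp [M, hDW]
  let f' : V → ℝ → ℝ := fun x s => fderiv ℝ φ (W s x) (ψ x) * volForm b (M x s) +
    φ (W s x) * ∑ j, volForm b (Function.update (M x s) j (fderiv ℝ ψ x (b j)))
  have hzero : ∀ s ∈ Icc (0 : ℝ) 1, ∫ x in K, f' x s ∂μ = 0 := by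
    intro s hs
    have := setIntegral_deriv_pullback_eq_zero (μ := μ) b hK hφ (hW s) hψ
      (fun x hx => h0 x hx s hs)
    simpa only [hM] using this
  have hcW : Continuous fun p : V × ℝ => W p.2 p.1 :=
    (hW₀.continuous.comp continuous_fst).add
      (continuous_snd.smul (hψ.continuous.comp continuous_fst))
  have hcM : Continuous fun p : V × ℝ => M p.1 p.2 := by
    refine continuous_pi fun k => ?_
    exact ((c0.comp continuous_fst).clm_apply continuous_const).add
      (continuous_snd.smul ((cψ.comp continuous_fst).clm_apply continuous_const))
  have hcf : Continuous (Function.uncurry f') := by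
    refine Continuous.add ?_ ?_
    · exact ((cφ.comp hcW).clm_apply (hψ.continuous.comp continuous_fst)).mul
        ((volForm b).cont.comp hcM)
    · refine (hφ.continuous.comp hcW).mul (continuous_finsetSum _ fun j _ => ?_)
      exact (volForm b).cont.comp
        (hcM.update j ((cψ.comp continuous_fst).clm_apply continuous_const))
  have hFTC : ∀ x, φ (W₁ x) * (fderiv ℝ W₁ x).det - φ (W₀ x) * (fderiv ℝ W₀ x).det =
      ∫ s in (0 : ℝ)..1, f' x s := by
    intro x
    have hder : ∀ s : ℝ, HasDerivAt (fun s => φ (W s x) * volForm b (M x s)) (f' x s) s := by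
      intro s
      have h1 : HasDerivAt (fun s => W s x) (ψ x) s := by
        simpa [W] using ((hasDerivAt_id s).smul_const (ψ x)).const_add (W₀ x)
      have h2 : HasDerivAt (fun s => φ (W s x)) (fderiv ℝ φ (W s x) (ψ x)) s :=
        (dφ _).hasFDerivAt.comp_hasDerivAt s h1
      have h3 : ∀ k, HasFDerivAt (fun s => M x s k)
          (ContinuousLinearMap.toSpanSingleton ℝ (fderiv ℝ ψ x (b k))) s := by
        intro k
        have : HasDerivAt (fun s => M x s k) (fderiv ℝ ψ x (b k)) s := by
          simpa [M] using
            ((hasDerivAt_id s).smul_const (fderiv ℝ ψ x (b k))).const_add (fderiv ℝ W₀ x (b k))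
        exact this.hasFDerivAt
      have h4 := (HasFDerivAt.multilinear_comp (f := volForm b) h3).hasDerivAt
      have h5 := h2.mul h4
      refine h5.congr_deriv ?_
      simp [f', ContinuousMultilinearMap.toContinuousLinearMap_apply]
    have := intervalIntegral.integral_eq_sub_of_hasDerivAt (fun s _ => hder s)
      ((hcf.comp (Continuous.prodMk_right x)).intervalIntegrable 0 1)
    have e1 : W 1 = W₁ := by ext y; simp [W, hψdef]
    have e0 : W 0 = W₀ := by ext y; simp [W]
    have e2 : ∀ s, volForm b (M x s) = (fderiv ℝ (W s) x).det := by
      intro s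
      rw [← hM, volForm_map_basis]
    simp only [e2, e1, e0] at this
    exact this.symm
  have hint : ∀ W : V → V, ContDiff ℝ ∞ W →
      IntegrableOn (fun x => φ (W x) * (fderiv ℝ W x).det) K μ := by
    intro W hW
    refine (Continuous.continuousOn ?_).integrableOn_compact hK
    refine (hφ.continuous.comp hW.continuous).mul ?_
    exact ContinuousLinearMap.continuous_det.comp (hW.continuous_fderiv (by simp))
  symm
  rw [← sub_eq_zero, ← integral_sub (hint _ hW₁) (hint _ hW₀)]
  simp only [hFTC, intervalIntegral.integral_of_le zero_le_one]
  rw [integral_integral_swap]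
  · rw [← integral_Icc_eq_integral_Ioc]
    exact setIntegral_eq_zero_of_forall_eq_zero hzero
  · rw [Measure.prod_restrict]
    exact (hcf.continuousOn.integrableOn_compact (hK.prod isCompact_Icc)).mono_set
      (Set.prod_mono_right Ioc_subset_Icc_self)

theorem segment_zero_notMem_iff {E : Type*} [AddCommGroup E] [Module ℝ E] {a b : E} :
    (0 : E) ∉ segment ℝ a b ↔ ∀ s ∈ Icc (0 : ℝ) 1, a + s • (b - a) ≠ 0 := by
  rw [segment_eq_image']
  simp

/-- A linear homotopy without zeros stays away from zero after scaling. -/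
theorem exists_scaled_pullback_eq {K : Set V} (hK : IsCompact K) {W₀ W₁ : V → V}
    (hW₀ : ContDiff ℝ ∞ W₀) (hW₁ : ContDiff ℝ ∞ W₁)
    (hseg : ∀ x ∈ frontier K, (0 : V) ∉ segment ℝ (W₀ x) (W₁ x)) {r : ℝ} (hr : 0 < r)
    (h0 : ∀ x ∈ frontier K, r ≤ ‖W₀ x‖) {φ : V → ℝ} (hφ : ContDiff ℝ ∞ φ)
    (hφr : tsupport φ ⊆ Metric.ball 0 r) :
    ∃ c : ℝ, 0 < c ∧ (∀ x ∈ frontier K, r ≤ ‖c • W₁ x‖) ∧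
      ∫ x in K, φ (W₀ x) * (fderiv ℝ W₀ x).det ∂μ =
        ∫ x in K, φ (c • W₁ x) * (fderiv ℝ (fun y => c • W₁ y) x).det ∂μ := by
  have hKf : IsCompact (frontier K) :=
    hK.of_isClosed_subset isClosed_frontier hK.isClosed.frontier_subset
  have hcont : Continuous fun p : V × ℝ => ‖W₀ p.1 + p.2 • (W₁ p.1 - W₀ p.1)‖ :=
    ((hW₀.continuous.comp continuous_fst).add (continuous_snd.smul
      ((hW₁.continuous.comp continuous_fst).sub (hW₀.continuous.comp continuous_fst)))).norm
  obtain ⟨ε, hε, hmin⟩ := (hKf.prod (isCompact_Icc (a := (0 : ℝ)) (b := 1))).exists_forall_le'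
    hcont.continuousOn (a := 0) (fun p hp => norm_pos_iff.2
      (segment_zero_notMem_iff.1 (hseg p.1 hp.1) p.2 hp.2))
  have hmin' : ∀ x ∈ frontier K, ∀ s ∈ Icc (0 : ℝ) 1, ε ≤ ‖W₀ x + s • (W₁ x - W₀ x)‖ :=
    fun x hx s hs => hmin (x, s) ⟨hx, hs⟩
  -- The homotopy has norm at least ε on the frontier, so multiplying by c ≥ r / ε brings it out of
  -- the ball of radius r. The bound c ≥ 1 keeps the path from `W₀` to `c • W₀` outside that ball as
  -- well.
  let c := max 1 (r / ε)
  have hc1 : 1 ≤ c := le_max_left _ _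
  have hc0 : 0 < c := by positivity
  have hcε : r ≤ c * ε := by
    have := le_max_right 1 (r / ε)
    rwa [div_le_iff₀ hε] at this
  have hout : ∀ y : V, r ≤ ‖y‖ → y ∉ tsupport φ := fun y hy h => by
    have := hφr h
    rw [mem_ball_zero_iff] at this
    linarith
  refine ⟨c, hc0, fun x hx => ?_, ?_⟩
  · have := hmin' x hx 1 (by simp)
    rw [norm_smul, Real.norm_of_nonneg hc0.le]
    rw [one_smul, add_sub_cancel] at this
    exact hcε.trans (by gcongr)
  · have hcW₀ : ContDiff ℝ ∞ fun y => c • W₀ y := contDiff_const.smul hW₀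
    have hcW₁ : ContDiff ℝ ∞ fun y => c • W₁ y := contDiff_const.smul hW₁
    refine (setIntegral_pullback_eq_of_homotopy hK hφ hW₀ hcW₀ ?_).trans
      (setIntegral_pullback_eq_of_homotopy hK hφ hcW₀ hcW₁ ?_)
    · intro x hx s hs
      apply hout
      have : W₀ x + s • (c • W₀ x - W₀ x) = (1 + s * (c - 1)) • W₀ x := by module
      have h1 : 1 ≤ 1 + s * (c - 1) := by nlinarith [hs.1]
      rw [this, norm_smul, Real.norm_of_nonneg (by linarith)]
      nlinarith [h0 x hx, norm_nonneg (W₀ x)]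
    · intro x hx s hs
      apply hout
      have : c • W₀ x + s • (c • W₁ x - c • W₀ x) = c • (W₀ x + s • (W₁ x - W₀ x)) := by module
      rw [this, norm_smul, Real.norm_of_nonneg hc0.le]
      exact hcε.trans (by gcongr; exact hmin' x hx s hs)

/-- For x outside K the segment from o to x meets the frontier, where the norm of L is already at
least r; hence φ(L(x - o)) = 0. The integral over K is thus one over the whole space, and a linear
change of variables leaves the sign of the determinant. -/
theorem setIntegral_pullback_linear {K : Set V} {L : V →L[ℝ] V} (hL : L.det ≠ 0)
    {o : V} (ho : o ∈ interior K) {r : ℝ} (h0 : ∀ x ∈ frontier K, r ≤ ‖L (x - o)‖) {φ : V → ℝ}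
    (hφr : tsupport φ ⊆ Metric.ball 0 r) :
    ∫ x in K, φ (L (x - o)) * (fderiv ℝ (fun x => L (x - o)) x).det ∂μ =
      (SignType.sign L.det : ℝ) * ∫ y, φ y ∂μ := by
  have hder : ∀ x, fderiv ℝ (fun x => L (x - o)) x = L := fun x =>
    (L.hasFDerivAt.comp x ((hasFDerivAt_id x).sub_const o)).fderiv
  simp only [hder]
  rw [setIntegral_eq_integral_of_forall_compl_eq_zero]
  · rw [integral_mul_const, integral_sub_right_eq_self (fun x => φ (L x)) o]
    have h1 := Measure.map_linearMap_addHaar_eq_smul_addHaar μ (f := (L : V →ₗ[ℝ] V)) hL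
    let e : V ≃L[ℝ] V := ContinuousLinearEquiv.equivOfInverse L
      (LinearMap.toContinuousLinearMap
        ((LinearMap.equivOfDetNeZero (L : V →ₗ[ℝ] V) hL).symm : V →ₗ[ℝ] V))
      (fun x => (LinearMap.equivOfDetNeZero (L : V →ₗ[ℝ] V) hL).symm_apply_apply x)
      (fun x => (LinearMap.equivOfDetNeZero (L : V →ₗ[ℝ] V) hL).apply_symm_apply x)
    have h2 : ∫ x, φ (L x) ∂μ = ∫ y, φ y ∂(Measure.map L μ) :=
      (e.toHomeomorph.measurableEmbedding.integral_map φ).symm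
    have h3 : Measure.map L μ = ENNReal.ofReal |(L.det)⁻¹| • μ := h1
    rw [h2, h3, integral_smul_measure, ENNReal.toReal_ofReal (abs_nonneg _), smul_eq_mul, abs_inv]
    have h4 : |L.det| ≠ 0 := abs_ne_zero.2 hL
    have h5 := sign_mul_abs L.det
    calc |L.det|⁻¹ * (∫ y, φ y ∂μ) * L.det
        = |L.det|⁻¹ * (∫ y, φ y ∂μ) * ((SignType.sign L.det : ℝ) * |L.det|) := by rw [h5]
      _ = _ := by field_simp
  · intro x hx
    obtain ⟨t, ht, htK⟩ := exists_mem_frontier_segment ho hx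
    have h1 := h0 _ htK
    rw [add_sub_cancel_left, map_smul, norm_smul, Real.norm_of_nonneg ht.1] at h1
    have h2 : L (x - o) ∉ tsupport φ := fun h => by
      have := hφr h
      rw [mem_ball_zero_iff] at this
      nlinarith [ht.2, norm_nonneg (L (x - o))]
    rw [image_eq_zero_of_notMem_tsupport h2, zero_mul]

end Homotopy

/-! ### From linear homotopies to the mapping degree. -/

section Degree

variable {V : Type*} [NormedAddCommGroup V] [InnerProductSpace ℝ V] [FiniteDimensional ℝ V]
  [MeasurableSpace V] [BorelSpace V]

/-- A vector field which is linearly homotopic without zeros, first to a smooth field and then to a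
linear isomorphism, has the degree of the latter. -/
theorem hasMappingDegree_of_homotopic_linear {K : Set V} (hK : IsCompact K) {o : V}
    (ho : o ∈ interior K) {g : V → V} (hg : ContinuousOn g (frontier K))
    (hg1 : ∀ x ∈ frontier K, ‖g x‖ = 1) {G : V → V} (hG : ContDiff ℝ ∞ G) {L : V →L[ℝ] V}
    {n : ℤ} (hn : (SignType.sign L.det : ℝ) = n) (hL : L.det ≠ 0)
    (hgG : ∀ x ∈ frontier K, (0 : V) ∉ segment ℝ (g x) (G x))
    (hGL : ∀ x ∈ frontier K, (0 : V) ∉ segment ℝ (G x) (L (x - o))) :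
    HasMappingDegree K g n := by
  refine ⟨hK, hg, hg1, ?_⟩
  have hKf : IsCompact (frontier K) :=
    hK.of_isClosed_subset isClosed_frontier hK.isClosed.frontier_subset
  have hcont : ContinuousOn (fun p : V × ℝ => ‖g p.1 + p.2 • (G p.1 - g p.1)‖)
      (frontier K ×ˢ Icc (0 : ℝ) 1) := by
    have h1 : ContinuousOn (fun p : V × ℝ => g p.1) (frontier K ×ˢ Icc (0 : ℝ) 1) :=
      hg.comp continuous_fst.continuousOn fun p hp => hp.1
    exact (h1.add (continuous_snd.continuousOn.smul
      ((hG.continuous.comp continuous_fst).continuousOn.sub h1))).norm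
  -- δ bounds from below the norm along the homotopy from g to G, so a δ-perturbation W of g is
  -- still homotopic to G without zeros.
  obtain ⟨δ, hδ, hmin⟩ := (hKf.prod (isCompact_Icc (a := (0 : ℝ)) (b := 1))).exists_forall_le'
    hcont (a := 0) (fun p hp => norm_pos_iff.2
      (segment_zero_notMem_iff.1 (hgG p.1 hp.1) p.2 hp.2))
  refine ⟨δ, hδ, fun W hW hWg r hr hWr φ hφ hφr => ?_⟩
  have hWG : ∀ x ∈ frontier K, (0 : V) ∉ segment ℝ (W x) (G x) := by
    intro x hx
    rw [segment_zero_notMem_iff]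
    intro s hs h
    have h1 : δ ≤ ‖g x + s • (G x - g x)‖ := hmin (x, s) ⟨hx, hs⟩
    have h2 : g x + s • (G x - g x) = -((1 - s) • (W x - g x)) := by
      rw [← sub_eq_zero, ← h]; module
    rw [h2, norm_neg, norm_smul, Real.norm_of_nonneg (by linarith [hs.2])] at h1
    nlinarith [hWg x hx, hs.1, norm_nonneg (W x - g x)]
  obtain ⟨c, hc, hcr, e1⟩ := exists_scaled_pullback_eq (μ := volume) hK hW hG hWG hr hWr hφ hφr
  have hcG : ContDiff ℝ ∞ fun y => c • G y := contDiff_const.smul hG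
  have hLo : ContDiff ℝ ∞ fun x => L (x - o) := L.contDiff.comp (contDiff_id.sub contDiff_const)
  -- Rescaling an endpoint by a positive factor does not affect whether 0 lies on the segment.
  have hGL' : ∀ x ∈ frontier K, (0 : V) ∉ segment ℝ (c • G x) (L (x - o)) := by
    intro x hx h
    apply hGL x hx
    obtain ⟨a, b, ha, hb, hab, h⟩ := h
    have hpos : 0 < a * c + b := by
      rcases ha.eq_or_lt with rfl | ha
      · linarith
      · positivity
    refine ⟨a * c / (a * c + b), b / (a * c + b), by positivity, by positivity, by field_simp, ?_⟩
    have : (a * c / (a * c + b)) • G x + (b / (a * c + b)) • L (x - o) =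
        (a * c + b)⁻¹ • (a • c • G x + b • L (x - o)) := by
      simp only [smul_add, smul_smul]
      congr 2 <;> field_simp
    rw [this, h, smul_zero]
  obtain ⟨c', hc', hcr', e2⟩ :=
    exists_scaled_pullback_eq (μ := volume) hK hcG hLo hGL' hr hcr hφ hφr
  have hdet : (c' • L).det = c' ^ Module.finrank ℝ V * L.det := by
    exact LinearMap.det_smul c' (L : V →ₗ[ℝ] V)
  have hdet0 : (c' • L).det ≠ 0 := by rw [hdet]; positivity
  have e3 := setIntegral_pullback_linear (μ := volume) (L := c' • L) hdet0 ho hcr' hφr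
  have hs : SignType.sign (c' • L).det = SignType.sign L.det := by
    rw [hdet, sign_mul, sign_pos (by positivity), one_mul]
  rw [e1, e2, ← hn, ← hs]
  exact e3

end Degree

/-! ### The index of the diagonal linear field. -/

section LinearIndex

theorem gaussMap_continuousOn {V : Type*} [NormedAddCommGroup V] [NormedSpace ℝ V] {U : V → V}
    {S : Set V} (hU : ContinuousOn U S) (h0 : ∀ x ∈ S, U x ≠ 0) : ContinuousOn (gaussMap U) S :=
  (hU.norm.inv₀ fun x hx => norm_ne_zero_iff.2 (h0 x hx)).smul hU

theorem norm_gaussMap {V : Type*} [NormedAddCommGroup V] [NormedSpace ℝ V] {U : V → V} {x : V}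
    (h : U x ≠ 0) : ‖gaussMap U x‖ = 1 := by
  rw [gaussMap, norm_smul, norm_inv, norm_norm, inv_mul_cancel₀ (norm_ne_zero_iff.2 h)]

/-- `linearField` as a linear map. -/
def linearFieldLin (m d : ℕ) : Space m →ₗ[ℝ] Space m where
  toFun := linearField m d
  map_add' x y := by
    ext i
    by_cases h : (i : ℕ) < d
    · simp [linearField, h]
    · simp [linearField, h]; ring
  map_smul' c x := by
    ext i
    by_cases h : (i : ℕ) < d <;> simp [linearField, h]

theorem prod_range_ite_neg_one (m d : ℕ) :
    ∏ i ∈ Finset.range m, (if i < d then (1 : ℝ) else -1) = (-1) ^ (m - d) := by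
  induction m with
  | zero => simp
  | succ m ih =>
    rw [Finset.prod_range_succ, ih]
    by_cases h : m < d
    · simp [h, Nat.sub_eq_zero_of_le h.le, Nat.sub_eq_zero_of_le (Nat.succ_le_of_lt h)]
    · rw [if_neg h, Nat.succ_sub (not_lt.1 h), pow_succ]

theorem det_linearFieldLin (m d : ℕ) : LinearMap.det (linearFieldLin m d) = (-1) ^ (m - d) := by
  let b := (EuclideanSpace.basisFun (Fin m) ℝ).toBasis
  have h : LinearMap.toMatrix b b (linearFieldLin m d) =
      Matrix.diagonal fun i : Fin m => if (i : ℕ) < d then (1 : ℝ) else -1 := by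
    ext i j
    rw [LinearMap.toMatrix_apply]
    by_cases hij : i = j
    · subst hij
      by_cases hi : (i : ℕ) < d <;> simp [b, linearFieldLin, linearField, hi]
    · by_cases hi : (i : ℕ) < d <;>
        simp [b, linearFieldLin, linearField, hi, hij]
  rw [← LinearMap.det_toMatrix b, h, Matrix.det_diagonal,
    Fin.prod_univ_eq_prod_range (fun i => if i < d then (1 : ℝ) else -1) m]
  exact prod_range_ite_neg_one m d

theorem sign_neg_one_pow (k : ℕ) :
    ((SignType.sign ((-1 : ℝ) ^ k) : SignType) : ℝ) = (((-1) ^ k : ℤ) : ℝ) := by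
  rcases neg_one_pow_eq_or ℝ k with h | h <;> simp [h]

/-- The Gauss map is a positive multiple of the linear field itself, so both homotopies are radial
and only the sign of the determinant matters. -/
theorem hasIndexAtOrigin_linearField (m d : ℕ) :
    HasIndexAtOrigin (linearField m d) ((-1) ^ (m - d)) := by
  intro ρ hρ
  let L : Space m →L[ℝ] Space m := LinearMap.toContinuousLinearMap (linearFieldLin m d)
  have hdet : L.det = (-1) ^ (m - d) := det_linearFieldLin m d
  have hne : ∀ x ∈ frontier (Metric.closedBall (0 : Space m) ρ), L x ≠ 0 := by
    intro x hx h
    have h1 : x = 0 := (LinearMap.equivOfDetNeZero (linearFieldLin m d)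
      (by rw [det_linearFieldLin]; positivity)).map_eq_zero_iff.1 h
    rw [h1] at hx
    exact hx.2 (mem_interior_iff_mem_nhds.2 (Metric.closedBall_mem_nhds _ hρ))
  have hseg : ∀ x ∈ frontier (Metric.closedBall (0 : Space m) ρ), ∀ c : ℝ, 0 < c →
      (0 : Space m) ∉ segment ℝ (c • L x) (L x) := by
    rintro x hx c hc ⟨a, b, ha, hb, hab, h⟩
    have : (a * c + b) • L x = 0 := by rw [← h]; module
    rcases smul_eq_zero.1 this with h1 | h1
    · rcases ha.eq_or_lt with rfl | ha
      · linarith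
      · have := mul_pos ha hc
        linarith
    · exact hne x hx h1
  refine hasMappingDegree_of_homotopic_linear (o := 0) (G := L) (L := L)
    (isCompact_closedBall _ _) (mem_interior_iff_mem_nhds.2 (Metric.closedBall_mem_nhds _ hρ))
    (gaussMap_continuousOn L.continuous.continuousOn hne) (fun x hx => norm_gaussMap (hne x hx))
    L.contDiff (by rw [hdet, sign_neg_one_pow]) (by rw [hdet]; positivity) ?_ ?_
  · intro x hx
    exact hseg x hx ‖L x‖⁻¹ (inv_pos.2 (norm_pos_iff.2 (hne x hx)))
  · intro x hx
    simpa using hseg x hx 1 one_pos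

end LinearIndex

/-! ### Rays and vertices of pointed polyhedra. -/

section Polyhedron

variable {V : Type*} [AddCommGroup V] [Module ℝ V]

theorem affine_add_smul (f : V →ᵃ[ℝ] ℝ) (x w : V) (t : ℝ) :
    f (x + t • w) = f x + t * f.linear w := by
  have := f.map_vadd x (t • w)
  simp only [vadd_eq_add, map_smul, smul_eq_mul] at this
  rw [add_comm x, this, add_comm]

theorem affine_add (f : V →ᵃ[ℝ] ℝ) (x w : V) : f (x + w) = f x + f.linear w := by
  simpa using affine_add_smul f x w 1

theorem affine_sub (f : V →ᵃ[ℝ] ℝ) (x y : V) : f.linear (x - y) = f x - f y := by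
  simpa using f.linearMap_vsub x y

/-- Orient w so that g w ≥ 0. If it is then a recession direction, g w = 0 and -w may be used
instead; w and -w cannot both be recession directions, by pointedness. -/
theorem exists_exit_direction {ι : Type*} {α : ι → V →ᵃ[ℝ] ℝ}
    (hpt : ∀ w, (∀ i, (α i).linear w = 0) → w = 0) (g : V →ₗ[ℝ] ℝ)
    (hray : ∀ w, (∀ i, 0 ≤ (α i).linear w) → g w ≤ 0) {w : V} (hw : w ≠ 0) :
    ∃ w', (w' = w ∨ w' = -w) ∧ 0 ≤ g w' ∧ ∃ i, (α i).linear w' < 0 := by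
  have key : ∀ w : V, w ≠ 0 → 0 ≤ g w →
      ∃ w', (w' = w ∨ w' = -w) ∧ 0 ≤ g w' ∧ ∃ i, (α i).linear w' < 0 := by
    intro w hw hg
    by_cases h : ∃ i, (α i).linear w < 0
    · exact ⟨w, Or.inl rfl, hg, h⟩
    · push Not at h
      refine ⟨-w, Or.inr rfl, by simpa using hray w h, ?_⟩
      by_contra! h'
      exact hw (hpt w fun i => le_antisymm (by simpa using h' i) (h i))
  rcases le_total 0 (g w) with h | h
  · exact key w hw h
  · obtain ⟨w', h1, h2⟩ := key (-w) (neg_ne_zero.2 hw) (by simpa using h)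
    exact ⟨w', by rw [neg_neg] at h1; exact h1.symm, h2⟩

/-- On a pointed polyhedron, a linear function either increases along a ray, or its value at any
point is at most its value at some vertex. -/
theorem exists_ray_or_vertex {ι : Type*} [Finite ι] {α : ι → V →ᵃ[ℝ] ℝ}
    (hpt : ∀ w, (∀ i, (α i).linear w = 0) → w = 0) (g : V →ₗ[ℝ] ℝ) {x : V}
    (hx : ∀ i, 0 ≤ α i x) :
    (∃ w, (∀ i, 0 ≤ (α i).linear w) ∧ 0 < g w) ∨
      ∃ y, (∀ i, 0 ≤ α i y) ∧ g x ≤ g y ∧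
        ∀ w, (∀ i, α i y = 0 → (α i).linear w = 0) → w = 0 := by
  by_cases hray : ∃ w, (∀ i, 0 ≤ (α i).linear w) ∧ 0 < g w
  · exact Or.inl hray
  right
  push Not at hray
  classical
  -- Induction on the number of inactive constraints: a point that is not a vertex is moved inside
  -- its face, without decreasing g, until it hits a further wall.
  induction hn : {i | α i x ≠ 0}.ncard using Nat.strong_induction_on generalizing x with
  | _ n ih =>
    by_cases hv : ∀ w, (∀ i, α i x = 0 → (α i).linear w = 0) → w = 0
    · exact ⟨x, hx, le_rfl, hv⟩
    push Not at hv
    obtain ⟨w₀, hw₀, hne⟩ := hv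
    obtain ⟨w, hww, hgw, i₀, hi₀⟩ := exists_exit_direction hpt g hray hne
    have hw : ∀ i, α i x = 0 → (α i).linear w = 0 := by
      intro i hi
      rcases hww with rfl | rfl <;> simp [hw₀ i hi]
    -- The ratio test: i is a wall that the ray from x in direction w reaches first.
    obtain ⟨i, hi, hmin⟩ := Set.exists_min_image {i | (α i).linear w < 0}
      (fun i => α i x / (-(α i).linear w)) (Set.toFinite _) ⟨i₀, hi₀⟩
    have hi : (α i).linear w < 0 := hi
    set t := α i x / (-(α i).linear w) with ht
    have ht0 : 0 ≤ t := div_nonneg (hx i) (by linarith)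
    have hnew : ∀ j, 0 ≤ α j (x + t • w) := by
      intro j
      rw [affine_add_smul]
      by_cases hj : (α j).linear w < 0
      · have := hmin j hj
        rw [le_div_iff₀ (by linarith)] at this
        linarith
      · have := mul_nonneg ht0 (not_lt.1 hj)
        linarith [hx j]
    have hiz : α i (x + t • w) = 0 := by
      rw [affine_add_smul, ht, div_neg, neg_mul, div_mul_cancel₀ _ hi.ne, add_neg_cancel]
    have hlt : {j | α j (x + t • w) ≠ 0}.ncard < n := by
      rw [← hn]
      refine Set.ncard_lt_ncard ?_ (Set.toFinite _)
      refine ⟨fun j hj hj0 => hj ?_, fun h => h (show α i x ≠ 0 from fun h0 => ?_) hiz⟩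
      · rw [affine_add_smul, hj0, hw j hj0]; simp
      · exact hi.ne (hw i h0)
    obtain ⟨y, h1, h2, h3⟩ := ih _ hlt hnew rfl
    refine ⟨y, h1, le_trans ?_ h2, h3⟩
    rw [map_add, map_smul, smul_eq_mul]
    have := mul_nonneg ht0 hgw
    linarith

/-- If `h` is negative at all vertices of an arrangement, then at each point where `h ≥ 0` there is
a recession direction of the closed face of that point along which `h` increases. -/
theorem exists_face_ray {ι : Type*} [Finite ι] {α : ι → V →ᵃ[ℝ] ℝ} {h : V →ᵃ[ℝ] ℝ}
    (hpt : ∀ w, (∀ i, (α i).linear w = 0) → w = 0)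
    (hneg : ∀ y, (∀ w, (∀ i, α i y = 0 → (α i).linear w = 0) → w = 0) → h y < 0) {x : V}
    (hx : 0 ≤ h x) :
    ∃ u, 0 < h.linear u ∧ ∀ i, (α i x = 0 → (α i).linear u = 0) ∧
      (0 ≤ α i x → 0 ≤ (α i).linear u) ∧ (α i x ≤ 0 → (α i).linear u ≤ 0) := by
  classical
  -- These inequalities cut out the closed face of x. The two copies of i agree unless α i x = 0;
  -- then they are α i ≥ 0 and -α i ≥ 0, which impose the equation.
  let β : ι ⊕ ι → V →ᵃ[ℝ] ℝ := Sum.elim (fun i => if 0 ≤ α i x then α i else -α i)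
    (fun i => if α i x ≤ 0 then -α i else α i)
  have hβ : ∀ j, ∃ i, β j = α i ∨ β j = -α i := by
    rintro (i | i)
    · by_cases h : 0 ≤ α i x
      · exact ⟨i, Or.inl (by simp [β, h])⟩
      · exact ⟨i, Or.inr (by simp [β, h])⟩
    · by_cases h : α i x ≤ 0
      · exact ⟨i, Or.inr (by simp [β, h])⟩
      · exact ⟨i, Or.inl (by simp [β, h])⟩
  have hβl : ∀ i, β (Sum.inl i) = α i ∨ β (Sum.inl i) = -α i := by
    intro i
    by_cases h : 0 ≤ α i x <;> simp [β, h]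
  have hlin : ∀ f : V →ᵃ[ℝ] ℝ, (-f).linear = -f.linear := fun f => rfl
  have hβpt : ∀ w, (∀ j, (β j).linear w = 0) → w = 0 := by
    refine fun w hw => hpt w fun i => ?_
    have := hw (Sum.inl i)
    rcases hβl i with h | h
    · rwa [h] at this
    · rw [h, hlin] at this
      simpa using this
  have hβx : ∀ j, 0 ≤ β j x := by
    rintro (i | i)
    · by_cases h : 0 ≤ α i x
      · simp [β, h]
      · simp [β, h]; linarith
    · by_cases h : α i x ≤ 0
      · simp [β, h]
      · simp [β, h]; linarith
  rcases exists_ray_or_vertex hβpt h.linear hβx with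
    ⟨u, hu, hhu⟩ | ⟨y, -, hy, hyv⟩
  · have h1 : ∀ i, 0 ≤ α i x → 0 ≤ (α i).linear u := fun i hi => by
      simpa [β, hi] using hu (Sum.inl i)
    have h2 : ∀ i, α i x ≤ 0 → (α i).linear u ≤ 0 := fun i hi => by
      simpa [β, hi, hlin] using hu (Sum.inr i)
    exact ⟨u, hhu, fun i => ⟨fun hi => le_antisymm (h2 i hi.le) (h1 i hi.ge), h1 i, h2 i⟩⟩
  · exfalso
    have : h y < 0 := by
      refine hneg y fun w hw => hyv w fun j hj => ?_
      obtain ⟨i, h | h⟩ := hβ j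
      · rw [h] at hj ⊢
        exact hw i hj
      · rw [h] at hj ⊢
        have := hw i (by simpa using hj)
        simp [hlin, this]
    have h3 := affine_sub h y x
    rw [map_sub] at h3
    linarith

end Polyhedron

/-! ### Equations of hyperplanes, sides and projective closures. -/

section Hyperplanes

variable {V : Type*} [NormedAddCommGroup V] [NormedSpace ℝ V]

theorem exists_affine_of_hyperplane [FiniteDimensional ℝ V] {H : AffineSubspace ℝ V}
    (hne : (H : Set V).Nonempty)
    (hd : Module.finrank ℝ H.direction + 1 = Module.finrank ℝ V) :
    ∃ f : V →ᵃ[ℝ] ℝ, ∀ x, x ∈ H ↔ f x = 0 := by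
  obtain ⟨p, hp⟩ := hne
  have hq : Module.finrank ℝ (V ⧸ H.direction) = Module.finrank ℝ ℝ := by
    have := H.direction.finrank_quotient_add_finrank
    rw [Module.finrank_self]
    omega
  let e := LinearEquiv.ofFinrankEq (V ⧸ H.direction) ℝ hq
  let l : V →ₗ[ℝ] ℝ := (e : _ →ₗ[ℝ] ℝ) ∘ₗ H.direction.mkQ
  refine ⟨l.toAffineMap - AffineMap.const ℝ V (l p), fun x => ?_⟩
  have : (l.toAffineMap - AffineMap.const ℝ V (l p)) x = e (H.direction.mkQ (x - p)) := by
    simp [l]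
  rw [this, e.map_eq_zero_iff, Submodule.mkQ_apply, Submodule.Quotient.mk_eq_zero]
  exact (AffineSubspace.vsub_right_mem_direction_iff_mem hp x).symm

variable {H : AffineSubspace ℝ V} {f : V →ᵃ[ℝ] ℝ}

theorem mem_direction_iff (hf : ∀ x, x ∈ H ↔ f x = 0) (hne : (H : Set V).Nonempty) {w : V} :
    w ∈ H.direction ↔ f.linear w = 0 := by
  obtain ⟨p, hp⟩ := hne
  rw [← AffineSubspace.vadd_mem_iff_mem_direction w hp, hf, vadd_eq_add, add_comm, affine_add,
    (hf p).1 hp, zero_add]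

theorem sSameSide_iff (hf : ∀ x, x ∈ H ↔ f x = 0) (hne : (H : Set V).Nonempty) {x y : V} :
    H.SSameSide x y ↔ 0 < f x * f y := by
  constructor
  · rintro ⟨⟨p, hp, q, hq, hr⟩, hx, hy⟩
    rw [hf] at hp hq hx hy
    have hxp : x -ᵥ p ≠ 0 := fun h => hx (by rw [vsub_eq_zero_iff_eq.1 h, hp])
    have hyq : y -ᵥ q ≠ 0 := fun h => hy (by rw [vsub_eq_zero_iff_eq.1 h, hq])
    obtain ⟨a, b, ha, hb, hab⟩ := hr.exists_pos hxp hyq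
    have h1 := congrArg f.linear hab
    simp only [map_smul, vsub_eq_sub, affine_sub, hp, hq, sub_zero, smul_eq_mul] at h1
    have h2 : 0 < (a * f x) ^ 2 := by positivity
    have h3 : (a * f x) ^ 2 = (a * b) * (f x * f y) := by
      rw [sq]; nth_rewrite 2 [h1]; ring
    rw [h3] at h2
    exact pos_of_mul_pos_right h2 (by positivity)
  · intro h
    obtain ⟨p, hp⟩ := hne
    have hp0 : f p = 0 := (hf p).1 hp
    have hx : f x ≠ 0 := fun h' => by simp [h'] at h
    have hy : f y ≠ 0 := fun h' => by simp [h'] at h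
    -- The second point is the projection of y to H parallel to x - p.
    refine ⟨⟨p, hp, y - (f y / f x) • (x - p), ?_, ?_⟩, by rwa [hf], by rwa [hf]⟩
    · rw [hf, sub_eq_add_neg, ← neg_smul, affine_add_smul, affine_sub, hp0]
      field_simp
      ring
    · have : 0 ≤ f y / f x := by
        rw [show f y / f x = (f x * f y) / (f x) ^ 2 by field_simp]
        positivity
      simpa using SameRay.sameRay_nonneg_smul_right (R := ℝ) (x - p) this

theorem sOppSide_of_mul_neg (hf : ∀ x, x ∈ H ↔ f x = 0) (hne : (H : Set V).Nonempty) {x y : V}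
    (h : f x * f y < 0) : H.SOppSide x y := by
  obtain ⟨p, hp⟩ := hne
  have hp0 : f p = 0 := (hf p).1 hp
  have hx : f x ≠ 0 := fun h' => by simp [h'] at h
  have hy : f y ≠ 0 := fun h' => by simp [h'] at h
  refine ⟨⟨p, hp, y + (-(f y / f x)) • (x - p), ?_, ?_⟩, by rwa [hf], by rwa [hf]⟩
  · rw [hf, affine_add_smul, affine_sub, hp0]
    field_simp
    ring
  · have : 0 ≤ -(f y / f x) := by
      rw [show -(f y / f x) = (-(f x * f y)) / (f x) ^ 2 by field_simp]
      exact div_nonneg (by linarith) (by positivity)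
    simpa using SameRay.sameRay_nonneg_smul_right (R := ℝ) (x - p) this

theorem affine_eq_linear_add (f : V →ᵃ[ℝ] ℝ) (x : V) : f x = f 0 + f.linear x := by
  simpa using affine_add f 0 x

/-- A vector with first coordinate 0 is a difference of two points (1, x) with x ∈ H; any other
vector is a multiple of one such point. -/
theorem mem_homogenize_iff {ℓ : ℕ} {H : AffineSubspace ℝ (Space ℓ)} {f : Space ℓ →ᵃ[ℝ] ℝ}
    (hf : ∀ x, x ∈ H ↔ f x = 0) (hne : (H : Set (Space ℓ)).Nonempty) {w : ℝ × Space ℓ} :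
    w ∈ homogenize H ↔ w.1 * f 0 + f.linear w.2 = 0 := by
  constructor
  · intro h
    induction h using Submodule.span_induction with
    | mem w hw =>
      obtain ⟨x, hx, rfl⟩ := hw
      rw [hf, affine_eq_linear_add] at hx
      simpa using hx
    | zero => simp
    | add x y _ _ hx hy =>
      simp only [Prod.fst_add, Prod.snd_add, map_add]
      linarith
    | smul a x _ hx =>
      simp only [Prod.smul_fst, Prod.smul_snd, map_smul, smul_eq_mul]
      linear_combination a * hx
  · intro h
    obtain ⟨p, hp⟩ := hne
    have hmem : ∀ x, x ∈ H → ((1 : ℝ), x) ∈ homogenize H := fun x hx =>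
      Submodule.subset_span ⟨x, hx, rfl⟩
    obtain ⟨t, w⟩ := w
    simp only at h
    by_cases ht : t = 0
    · subst ht
      have h1 : p + w ∈ H := by
        rw [hf, affine_add, (hf p).1 hp]
        linarith
      have := (homogenize H).sub_mem (hmem _ h1) (hmem p hp)
      simpa using this
    · have h1 : t⁻¹ • w ∈ H := by
        rw [hf, affine_eq_linear_add, map_smul, smul_eq_mul]
        field_simp
        linarith
      have := (homogenize H).smul_mem t (hmem _ h1)
      simpa [smul_smul, ht] using this

end Hyperplanes

/-! ### Chambers as sign cells. -/

section Chambers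

variable {ℓ : ℕ} {A : Set (AffineSubspace ℝ (Space ℓ))} {α : A → Space ℓ →ᵃ[ℝ] ℝ}

/-- A sign cell is convex, hence connected; conversely, a sign change inside a connected set would
produce a zero of some α H by the intermediate value theorem. -/
theorem connectedComponentIn_compl (hα : ∀ (H : A) (x : Space ℓ), x ∈ H.1 ↔ α H x = 0)
    {x : Space ℓ} (hx : x ∈ compl A) :
    connectedComponentIn (compl A) x = {y | ∀ H, 0 < α H x * α H y} := by
  have hx0 : ∀ H : A, α H x ≠ 0 := fun H h => hx H.1 H.2 ((hα H x).2 h)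
  have hc : ∀ H : A, Continuous (α H) := fun H => AffineMap.continuous_of_finiteDimensional _
  apply Subset.antisymm
  · intro y hy H
    by_contra! hn
    have hpre := isPreconnected_connectedComponentIn (F := compl A) (x := x)
    have hxm := mem_connectedComponentIn hx
    obtain ⟨z, hz, hz0⟩ : ∃ z ∈ connectedComponentIn (compl A) x, α H x * α H z = 0 := by
      have := hpre.intermediate_value hy hxm
        (f := fun z => α H x * α H z) (continuous_const.mul (hc H)).continuousOn
      exact this ⟨hn, mul_self_nonneg _⟩
    have : α H z = 0 := (mul_eq_zero.1 hz0).resolve_left (hx0 H)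
    exact connectedComponentIn_subset _ _ hz H.1 H.2 ((hα H z).2 this)
  · refine IsPreconnected.subset_connectedComponentIn ?_ ?_ ?_
    · apply Convex.isPreconnected
      have : {y | ∀ H, 0 < α H x * α H y} =
          ⋂ H, (α H x • α H : Space ℓ →ᵃ[ℝ] ℝ) ⁻¹' Ioi 0 := by
        ext y; simp
      rw [this]
      exact convex_iInter fun H => (convex_Ioi 0).affine_preimage _
    · exact fun H => mul_self_pos.2 (hx0 H)
    · intro y hy H hH hyH
      have := hy ⟨H, hH⟩
      rw [(hα ⟨H, hH⟩ y).1 hyH, mul_zero] at this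
      exact lt_irrefl _ this

theorem mem_chambers_of_signs (hα : ∀ (H : A) (x : Space ℓ), x ∈ H.1 ↔ α H x = 0)
    {x : Space ℓ} (hx : ∀ H, α H x ≠ 0) : {y | ∀ H, 0 < α H x * α H y} ∈ chambers A := by
  have hx' : x ∈ compl A := fun H hH h => hx ⟨H, hH⟩ ((hα ⟨H, hH⟩ x).1 h)
  exact ⟨x, hx', (connectedComponentIn_compl hα hx').symm⟩

theorem eq_of_mem_chambers (hα : ∀ (H : A) (x : Space ℓ), x ∈ H.1 ↔ α H x = 0)
    {D : Set (Space ℓ)} (hD : D ∈ chambers A) {y : Space ℓ} (hy : y ∈ D) :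
    D = {z | ∀ H, 0 < α H y * α H z} := by
  obtain ⟨x, hx, rfl⟩ := hD
  have hy' : y ∈ compl A := connectedComponentIn_subset _ _ hy
  rw [← connectedComponentIn_compl hα hy', connectedComponentIn_eq hy]

end Chambers

/-- A chamber `C = {α > 0}` of an essential arrangement `A` with a bounded section by a hyperplane
`F = {h = 0}` which has all vertices of `A` on the side `h < 0`. -/
structure IsBoundedSection {ℓ : ℕ} (A : Set (AffineSubspace ℝ (Space ℓ)))
    (α : A → Space ℓ →ᵃ[ℝ] ℝ) (F : AffineSubspace ℝ (Space ℓ)) (h : Space ℓ →ᵃ[ℝ] ℝ)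
    (C : Set (Space ℓ)) : Prop where
  finite : A.Finite
  nonempty : ∀ H : A, (H.1 : Set (Space ℓ)).Nonempty
  mem_iff : ∀ (H : A) (x : Space ℓ), x ∈ H.1 ↔ α H x = 0
  pointed : ∀ w, (∀ H, (α H).linear w = 0) → w = 0
  mem_section : ∀ x, x ∈ F ↔ h x = 0
  vertex_neg : ∀ y, (∀ w, (∀ H, α H y = 0 → (α H).linear w = 0) → w = 0) → h y < 0
  chamber : C = {x | ∀ H, 0 < α H x}
  section_nonempty : (C ∩ (F : Set (Space ℓ))).Nonempty
  section_bounded : Bornology.IsBounded (C ∩ (F : Set (Space ℓ)))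

/-! ### The recession cone and its parallel walls. -/

/-- The functional `α i` is constant along all recession directions of the polyhedron `α ≥ 0`. -/
def IsParallel {V ι : Type*} [AddCommGroup V] [Module ℝ V] (α : ι → V →ᵃ[ℝ] ℝ) (i : ι) : Prop :=
  ∀ v, (∀ j, 0 ≤ (α j).linear v) → (α i).linear v = 0

/-- The common kernel of the functionals which are constant along all recession directions. -/
def parallelSpace {V ι : Type*} [AddCommGroup V] [Module ℝ V] (α : ι → V →ᵃ[ℝ] ℝ) :
    Submodule ℝ V :=
  ⨅ i : {i // IsParallel α i}, LinearMap.ker (α i.1).linear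

theorem mem_parallelSpace {V ι : Type*} [AddCommGroup V] [Module ℝ V] {α : ι → V →ᵃ[ℝ] ℝ} {v : V} :
    v ∈ parallelSpace α ↔ ∀ i, IsParallel α i → (α i).linear v = 0 := by
  simp [parallelSpace]

theorem recession_mem_parallelSpace {V ι : Type*} [AddCommGroup V] [Module ℝ V]
    {α : ι → V →ᵃ[ℝ] ℝ} {v : V} (hv : ∀ j, 0 ≤ (α j).linear v) : v ∈ parallelSpace α :=
  mem_parallelSpace.2 fun _ hi => hi v hv

/-- Each non-parallel functional is positive on some recession direction; the sum of these
directions serves all of them. It plays the role of a relative interior point of the recession cone.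
-/
theorem exists_recession_pos {V ι : Type*} [AddCommGroup V] [Module ℝ V] [Finite ι]
    (α : ι → V →ᵃ[ℝ] ℝ) :
    ∃ v, (∀ j, 0 ≤ (α j).linear v) ∧ ∀ i, ¬ IsParallel α i → 0 < (α i).linear v := by
  classical
  have := Fintype.ofFinite ι
  have hw : ∀ i, ∃ v, (∀ j, 0 ≤ (α j).linear v) ∧ (¬ IsParallel α i → 0 < (α i).linear v) := by
    intro i
    by_cases h : IsParallel α i
    · exact ⟨0, by simp, fun h' => absurd h h'⟩
    · obtain ⟨v, hv, hv0⟩ := not_forall₂.1 h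
      exact ⟨v, hv, fun _ => lt_of_le_of_ne (hv i) (Ne.symm hv0)⟩
  choose v hv hvp using hw
  refine ⟨∑ i, v i, fun j => ?_, fun i hi => ?_⟩
  · rw [map_sum]
    exact Finset.sum_nonneg fun i _ => hv i j
  · rw [map_sum]
    exact Finset.sum_pos' (fun k _ => hv k i) ⟨i, Finset.mem_univ _, hvp i hi⟩

/-- A vector on which the non-constant functionals are large enough is a recession direction, up
to the constant ones. -/
theorem exists_forall_pos_add_smul {V ι : Type*} [AddCommGroup V] [Module ℝ V] [Finite ι]
    (l : ι → V →ₗ[ℝ] ℝ) (c : ι → ℝ) {P : ι → Prop} {v : V} (hv : ∀ i, P i → 0 < l i v) :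
    ∀ᶠ t : ℝ in atTop, ∀ i, P i → 0 < c i + t * l i v := by
  rw [eventually_all]
  intro i
  by_cases h : P i
  · have h1 : Tendsto (fun t : ℝ => c i + t * l i v) atTop atTop :=
      tendsto_atTop_add_const_left _ _ (tendsto_id.atTop_mul_const (hv i h))
    filter_upwards [h1.eventually_gt_atTop 0] with t ht _ using ht
  · exact Eventually.of_forall fun t h' => absurd h' h

/-- If w lies in the common kernel and v is relatively interior to the cone, then w + t v is a
recession direction for large t, so w is a difference of elements of the span. -/
theorem span_recession_eq {V ι : Type*} [AddCommGroup V] [Module ℝ V] [Finite ι]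
    (α : ι → V →ᵃ[ℝ] ℝ) :
    Submodule.span ℝ {v | ∀ j, 0 ≤ (α j).linear v} = parallelSpace α := by
  apply le_antisymm
  · exact Submodule.span_le.2 fun v hv => recession_mem_parallelSpace hv
  · intro w hw
    obtain ⟨v, hv, hvp⟩ := exists_recession_pos α
    obtain ⟨t, ht⟩ := (exists_forall_pos_add_smul (fun i => (α i).linear)
      (fun i => (α i).linear w) hvp).exists
    have h1 : w + t • v ∈ Submodule.span ℝ {v | ∀ j, 0 ≤ (α j).linear v} := by
      apply Submodule.subset_span
      intro j
      rw [map_add, map_smul, smul_eq_mul]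
      by_cases hj : IsParallel α j
      · rw [mem_parallelSpace.1 hw j hj, hj v hv]; simp
      · exact (ht j hj).le
    have h2 : v ∈ Submodule.span ℝ {v | ∀ j, 0 ≤ (α j).linear v} := Submodule.subset_span hv
    simpa using Submodule.sub_mem _ h1 (Submodule.smul_mem _ t h2)

/-- Adding a large multiple of a relatively interior direction makes x a recession direction without
changing its parallel values, which must therefore be zero. -/
theorem mem_parallelSpace_of_nonneg {V ι : Type*} [AddCommGroup V] [Module ℝ V] [Finite ι]
    {α : ι → V →ᵃ[ℝ] ℝ} {x : V} (hx : ∀ i, IsParallel α i → 0 ≤ (α i).linear x) :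
    x ∈ parallelSpace α := by
  obtain ⟨v, hv, hvp⟩ := exists_recession_pos α
  obtain ⟨t, ht⟩ := (exists_forall_pos_add_smul (fun i => (α i).linear)
    (fun i => (α i).linear x) hvp).exists
  rw [mem_parallelSpace]
  intro i hi
  have h1 := hi (x + t • v) fun j => by
    rw [map_add, map_smul, smul_eq_mul]
    by_cases hj : IsParallel α j
    · rw [hj v hv]; simpa using hx j hj
    · exact (ht j hj).le
  rw [map_add, map_smul, hi v hv] at h1
  simpa using h1

/-- The chamber on the other side of the non-parallel hyperplanes. -/
def oppositeChamber {V ι : Type*} [AddCommGroup V] [Module ℝ V] (α : ι → V →ᵃ[ℝ] ℝ) : Set V :=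
  {y | ∀ i, (IsParallel α i → 0 < α i y) ∧ (¬ IsParallel α i → α i y < 0)}

theorem eventually_mem_oppositeChamber {V ι : Type*} [AddCommGroup V] [Module ℝ V] [Finite ι]
    {α : ι → V →ᵃ[ℝ] ℝ} {p v : V} (hp : ∀ i, 0 < α i p)
    (hv : ∀ i, 0 ≤ (α i).linear v) (hvp : ∀ i, ¬ IsParallel α i → 0 < (α i).linear v) :
    ∀ᶠ t : ℝ in atTop, p - t • v ∈ oppositeChamber α := by
  filter_upwards [exists_forall_pos_add_smul (fun i => (α i).linear) (fun i => -α i p) hvp]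
    with t ht i
  rw [sub_eq_add_neg, ← neg_smul, affine_add_smul]
  refine ⟨fun hi => ?_, fun hi => ?_⟩
  · rw [hi v hv]; simpa using hp i
  · linarith [ht i hi]

/-! ### Consequences of bounded section: growth of `h` and the opposite chamber. -/

namespace IsBoundedSection

variable {ℓ : ℕ} {A : Set (AffineSubspace ℝ (Space ℓ))} {α : A → Space ℓ →ᵃ[ℝ] ℝ}
  {F : AffineSubspace ℝ (Space ℓ)} {h : Space ℓ →ᵃ[ℝ] ℝ} {C : Set (Space ℓ)}

theorem finite_index (S : IsBoundedSection A α F h C) : Finite A := S.finite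

theorem exists_face_ray (S : IsBoundedSection A α F h C) {x : Space ℓ} (hx : 0 ≤ h x) :
    ∃ u, 0 < h.linear u ∧ ∀ H, (α H x = 0 → (α H).linear u = 0) ∧
      (0 ≤ α H x → 0 ≤ (α H).linear u) ∧ (α H x ≤ 0 → (α H).linear u ≤ 0) :=
  have := S.finite_index
  Arrangement.exists_face_ray S.pointed S.vertex_neg hx

/-- Otherwise C ∩ F would contain a ray. -/
theorem eq_zero_of_recession_of_direction (S : IsBoundedSection A α F h C) {w : Space ℓ}
    (hw : ∀ H, 0 ≤ (α H).linear w) (hh : h.linear w = 0) : w = 0 := by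
  by_contra hne
  obtain ⟨x, hxC, hxF⟩ := S.section_nonempty
  obtain ⟨R, hR⟩ := S.section_bounded.subset_closedBall 0
  have hmem : ∀ t : ℝ, 0 ≤ t → ‖x + t • w‖ ≤ R := by
    intro t ht
    have : x + t • w ∈ C ∩ (F : Set (Space ℓ)) := by
      refine ⟨?_, (S.mem_section _).2 ?_⟩
      · rw [S.chamber] at hxC ⊢
        intro H
        rw [affine_add_smul]
        have := mul_nonneg ht (hw H)
        linarith [hxC H]
      · rw [affine_add_smul, (S.mem_section x).1 hxF, hh]; simp
    simpa using hR this
  have hpos : 0 < ‖w‖ := norm_pos_iff.2 hne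
  have hR0 : 0 ≤ R := (norm_nonneg _).trans (hmem 0 le_rfl)
  have h1 := hmem ((R + ‖x‖ + 1) / ‖w‖) (by positivity)
  have h2 : ‖((R + ‖x‖ + 1) / ‖w‖) • w‖ = R + ‖x‖ + 1 := by
    rw [norm_smul, Real.norm_of_nonneg (by positivity)]
    field_simp
  have h3 := norm_sub_norm_le (((R + ‖x‖ + 1) / ‖w‖) • w) (-x)
  rw [sub_neg_eq_add, norm_neg, add_comm _ x, h2] at h3
  linarith

/-- If h does not increase along w, some nonnegative combination of w with a face ray u is a
recession direction tangent to F, hence zero. Each α_H is nonnegative on both summands, so it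
vanishes on w, and pointedness gives w = 0. -/
theorem linear_pos_of_recession (S : IsBoundedSection A α F h C) {w : Space ℓ}
    (hw : ∀ H, 0 ≤ (α H).linear w) (hne : w ≠ 0) : 0 < h.linear w := by
  by_contra! hle
  obtain ⟨x, hxC, hxF⟩ := S.section_nonempty
  rw [S.chamber] at hxC
  obtain ⟨u, hu, huH⟩ := S.exists_face_ray ((S.mem_section x).1 hxF).ge
  have hur : ∀ H, 0 ≤ (α H).linear u := fun H => (huH H).2.1 (hxC H).le
  have h1 : h.linear u • w + (-h.linear w) • u = 0 := by
    refine S.eq_zero_of_recession_of_direction (fun H => ?_) ?_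
    · have := mul_nonneg hu.le (hw H)
      have := mul_nonneg (neg_nonneg.2 hle) (hur H)
      simp only [map_add, map_smul, smul_eq_mul]
      linarith
    · simp only [map_add, map_smul, smul_eq_mul]
      ring
  apply hne
  refine S.pointed w fun H => ?_
  have h2 := congrArg (α H).linear h1
  simp only [map_add, map_smul, smul_eq_mul, map_zero] at h2
  have h3 := mul_nonneg (neg_nonneg.2 hle) (hur H)
  have h4 := mul_nonneg hu.le (hw H)
  have h5 : h.linear u * (α H).linear w = 0 := by linarith
  exact (mul_eq_zero.1 h5).resolve_left hu.ne'

theorem exists_interior_recession (S : IsBoundedSection A α F h C) :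
    ∃ v, (∀ H, 0 ≤ (α H).linear v) ∧ (∀ H, ¬ IsParallel α H → 0 < (α H).linear v) ∧
      0 < h.linear v := by
  have := S.finite_index
  obtain ⟨v, hv, hvp⟩ := exists_recession_pos α
  refine ⟨v, hv, hvp, S.linear_pos_of_recession hv ?_⟩
  rintro rfl
  obtain ⟨x, hxC, hxF⟩ := S.section_nonempty
  rw [S.chamber] at hxC
  obtain ⟨u, hu, huH⟩ := S.exists_face_ray ((S.mem_section x).1 hxF).ge
  have hur : ∀ H, 0 ≤ (α H).linear u := fun H => (huH H).2.1 (hxC H).le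
  have : u = 0 := S.pointed u fun H => by
    by_cases hH : IsParallel α H
    · exact hH u hur
    · have := hvp H hH
      simp at this
  simp [this] at hu

/-- A face ray u at a common point is nonnegative on the parallel functionals, hence lies in
`parallelSpace α`, and nonpositive on the others. So -u is a recession direction of C along which h
decreases. -/
theorem oppositeChamber_disjoint (S : IsBoundedSection A α F h C) :
    oppositeChamber α ∩ (F : Set (Space ℓ)) = ∅ := by
  have := S.finite_index
  rw [Set.eq_empty_iff_forall_notMem]
  rintro y ⟨hyD, hyF⟩
  obtain ⟨u, hu, huH⟩ := S.exists_face_ray ((S.mem_section y).1 hyF).ge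
  have huE : u ∈ parallelSpace α :=
    mem_parallelSpace_of_nonneg fun H hH => (huH H).2.1 ((hyD H).1 hH).le
  have h1 : 0 < h.linear (-u) := by
    refine S.linear_pos_of_recession (fun H => ?_) ?_
    · rw [map_neg, neg_nonneg]
      by_cases hH : IsParallel α H
      · rw [mem_parallelSpace.1 huE H hH]
      · exact (huH H).2.2 ((hyD H).2 hH).le
    · rintro h0
      rw [neg_eq_zero] at h0
      simp [h0] at hu
  rw [map_neg] at h1
  linarith

theorem exists_mem_oppositeChamber (S : IsBoundedSection A α F h C) :
    ∃ y ∈ oppositeChamber α, h y < 0 := by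
  have := S.finite_index
  obtain ⟨v, hv, hvp, hhv⟩ := S.exists_interior_recession
  obtain ⟨x, hxC, hxF⟩ := S.section_nonempty
  rw [S.chamber] at hxC
  obtain ⟨t, ht, ht0⟩ := ((eventually_mem_oppositeChamber hxC hv hvp).and
    (eventually_gt_atTop 0)).exists
  refine ⟨x - t • v, ht, ?_⟩
  rw [sub_eq_add_neg, ← neg_smul, affine_add_smul, (S.mem_section x).1 hxF]
  have := mul_pos ht0 hhv
  linarith

theorem oppositeChamber_eq {y : Space ℓ} (hy : y ∈ oppositeChamber α) :
    oppositeChamber α = {z | ∀ H, 0 < α H y * α H z} := by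
  ext z
  refine forall_congr' fun H => ?_
  by_cases hH : IsParallel α H
  · simp [hH, (hy H).1 hH]
  · have hn := (hy H).2 hH
    simp only [hH, IsEmpty.forall_iff, not_false_eq_true, forall_const, true_and]
    exact ⟨mul_pos_of_neg_of_neg hn, fun h0 => by by_contra! h1; nlinarith⟩

theorem oppositeChamber_mem_chambers (S : IsBoundedSection A α F h C) :
    oppositeChamber α ∈ chambers A := by
  obtain ⟨y, hy, -⟩ := S.exists_mem_oppositeChamber
  rw [oppositeChamber_eq hy]
  refine mem_chambers_of_signs S.mem_iff fun H => ?_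
  by_cases hH : IsParallel α H
  · exact ((hy H).1 hH).ne'
  · exact ((hy H).2 hH).ne

theorem closure_chamber (S : IsBoundedSection A α F h C) : closure C = {x | ∀ H, 0 ≤ α H x} := by
  have hc : ∀ H : A, Continuous (α H) := fun H => AffineMap.continuous_of_finiteDimensional _
  apply Subset.antisymm
  · refine closure_minimal ?_ ?_
    · rw [S.chamber]
      exact fun x hx H => (hx H).le
    · simp only [ofPred_forall]
      exact isClosed_iInter fun H => isClosed_le continuous_const (hc H)
  · intro x hx
    obtain ⟨p, hp, -⟩ := S.section_nonempty
    rw [S.chamber] at hp ⊢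
    have h1 : Tendsto (fun t : ℝ => x + t • (p - x)) (𝓝[>] 0) (𝓝 x) := by
      have : Continuous fun t : ℝ => x + t • (p - x) := by fun_prop
      have := this.tendsto 0
      rw [zero_smul, add_zero] at this
      exact this.mono_left nhdsWithin_le_nhds
    refine mem_closure_of_tendsto h1 ?_
    filter_upwards [self_mem_nhdsWithin, nhdsWithin_le_nhds (gt_mem_nhds zero_lt_one)]
      with t ht ht1 H
    rw [affine_add_smul, affine_sub]
    have h2 := mul_pos ht (hp H)
    have h3 := mul_nonneg (sub_nonneg.2 ht1.le) (hx H)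
    linarith

theorem isOpen_chamber (S : IsBoundedSection A α F h C) : IsOpen C := by
  have := S.finite_index
  have hc : ∀ H : A, Continuous (α H) := fun H => AffineMap.continuous_of_finiteDimensional _
  rw [S.chamber]
  simp only [ofPred_forall]
  exact isOpen_iInter_of_finite fun H => isOpen_lt continuous_const (hc H)

end IsBoundedSection

/-! ### The boundary at infinity in projective space. -/

section Cones

variable {ℓ : ℕ} {P : ℝ × Space ℓ → Prop}

theorem rep_mk_iff (hP : ∀ (a : ℝ) (v : ℝ × Space ℓ), a ≠ 0 → (P (a • v) ↔ P v))
    {v : ℝ × Space ℓ} (hv : v ≠ 0) : P (Projectivization.mk ℝ v hv).rep ↔ P v := by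
  obtain ⟨a, ha⟩ := Projectivization.exists_smul_eq_mk_rep ℝ v hv
  rw [← ha]
  exact hP a v a.ne_zero

theorem isOpen_setOf_rep (hP : ∀ (a : ℝ) (v : ℝ × Space ℓ), a ≠ 0 → (P (a • v) ↔ P v))
    (ho : IsOpen {v | P v}) : IsOpen {p : ℙ ℝ (ℝ × Space ℓ) | P p.rep} := by
  rw [isOpen_coinduced]
  convert ho.preimage continuous_subtype_val using 1
  ext v
  exact rep_mk_iff hP v.2

theorem isClosed_setOf_rep (hP : ∀ (a : ℝ) (v : ℝ × Space ℓ), a ≠ 0 → (P (a • v) ↔ P v))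
    (ho : IsClosed {v | P v}) : IsClosed {p : ℙ ℝ (ℝ × Space ℓ) | P p.rep} := by
  rw [isClosed_coinduced]
  convert ho.preimage continuous_subtype_val using 1
  ext v
  exact rep_mk_iff hP v.2

theorem continuous_mk {ℓ : ℕ} : Continuous
    (fun v : {v : ℝ × Space ℓ // v ≠ 0} => Projectivization.mk ℝ v.1 v.2) :=
  continuous_coinduced_rng

theorem atInfinity_neg {ℓ : ℕ} {v : Space ℓ} (hv : v ≠ 0) :
    atInfinity (-v) (neg_ne_zero.2 hv) = atInfinity v hv := by
  rw [atInfinity, atInfinity, Projectivization.mk_eq_mk_iff']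
  exact ⟨-1, by simp⟩

end Cones

/-- The homogeneous linear form on `ℝ × ℝ^ℓ` of an affine function on `ℝ^ℓ`. -/
noncomputable def homogForm {ℓ : ℕ} (f : Space ℓ →ᵃ[ℝ] ℝ) : ℝ × Space ℓ →ₗ[ℝ] ℝ :=
  (f 0) • LinearMap.fst ℝ ℝ (Space ℓ) + f.linear ∘ₗ LinearMap.snd ℝ ℝ (Space ℓ)

theorem homogForm_apply {ℓ : ℕ} (f : Space ℓ →ᵃ[ℝ] ℝ) (w : ℝ × Space ℓ) :
    homogForm f w = w.1 * f 0 + f.linear w.2 := by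
  simp [homogForm, mul_comm]

theorem homogForm_one {ℓ : ℕ} (f : Space ℓ →ᵃ[ℝ] ℝ) (x : Space ℓ) :
    homogForm f (1, x) = f x := by
  rw [homogForm_apply, affine_eq_linear_add f x, one_mul]

theorem continuous_homogForm {ℓ : ℕ} (f : Space ℓ →ᵃ[ℝ] ℝ) : Continuous (homogForm f) :=
  LinearMap.continuous_of_finiteDimensional _

section Signs

variable {ℓ : ℕ} {ι : Type*} {f : ι → ℝ × Space ℓ →ₗ[ℝ] ℝ} {Q : ι → Prop}

/-- A projective point determines its representatives only up to sign, so sign conditions descend to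
projective space only in this two-sided form. -/
theorem nonneg_or_nonpos_smul_iff (a : ℝ) (v : ℝ × Space ℓ) (ha : a ≠ 0) :
    ((∀ i, Q i → 0 ≤ f i (a • v)) ∨ ∀ i, Q i → f i (a • v) ≤ 0) ↔
      ((∀ i, Q i → 0 ≤ f i v) ∨ ∀ i, Q i → f i v ≤ 0) := by
  simp only [map_smul, smul_eq_mul]
  rcases ha.lt_or_gt with h | h
  · have h1 : ∀ x, 0 ≤ a * x ↔ x ≤ 0 := fun x => ⟨fun _ => by nlinarith, fun _ => by nlinarith⟩
    have h2 : ∀ x, a * x ≤ 0 ↔ 0 ≤ x := fun x => ⟨fun _ => by nlinarith, fun _ => by nlinarith⟩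
    simp only [h1, h2]
    exact or_comm
  · have h2 : ∀ x, a * x ≤ 0 ↔ x ≤ 0 := fun x => ⟨fun _ => by nlinarith, fun _ => by nlinarith⟩
    simp only [mul_nonneg_iff_of_pos_left h, h2]

theorem pos_or_neg_smul_iff (a : ℝ) (v : ℝ × Space ℓ) (ha : a ≠ 0) :
    ((∀ i, Q i → 0 < f i (a • v)) ∨ ∀ i, Q i → f i (a • v) < 0) ↔
      ((∀ i, Q i → 0 < f i v) ∨ ∀ i, Q i → f i v < 0) := by
  simp only [map_smul, smul_eq_mul]
  rcases ha.lt_or_gt with h | h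
  · have h1 : ∀ x, 0 < a * x ↔ x < 0 := fun x => ⟨fun _ => by nlinarith, fun _ => by nlinarith⟩
    have h2 : ∀ x, a * x < 0 ↔ 0 < x := fun x => ⟨fun _ => by nlinarith, fun _ => by nlinarith⟩
    simp only [h1, h2]
    exact or_comm
  · have h2 : ∀ x, a * x < 0 ↔ x < 0 := fun x => ⟨fun _ => by nlinarith, fun _ => by nlinarith⟩
    simp only [mul_pos_iff_of_pos_left h, h2]

end Signs

namespace IsBoundedSection

variable {ℓ : ℕ} {A : Set (AffineSubspace ℝ (Space ℓ))} {α : A → Space ℓ →ᵃ[ℝ] ℝ}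
  {F : AffineSubspace ℝ (Space ℓ)} {h : Space ℓ →ᵃ[ℝ] ℝ} {C : Set (Space ℓ)}

theorem atInfinity_mem_closure (S : IsBoundedSection A α F h C) {v : Space ℓ} (hv : v ≠ 0)
    (hr : ∀ H, 0 ≤ (α H).linear v) : atInfinity v hv ∈ closure (toProj '' C) := by
  obtain ⟨p, hp, -⟩ := S.section_nonempty
  rw [S.chamber] at hp
  have hne : ∀ τ : ℝ, ((τ, τ • p + v) : ℝ × Space ℓ) ≠ 0 := by
    intro τ h0
    obtain ⟨h1, h2⟩ := Prod.mk_eq_zero.1 h0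
    subst h1
    simp at h2
    exact hv h2
  -- For τ > 0 this represents the affine point p + τ⁻¹ v of C; at τ = 0 it represents the point at
  -- infinity.
  let γ : ℝ → {v : ℝ × Space ℓ // v ≠ 0} := fun τ => ⟨(τ, τ • p + v), hne τ⟩
  have hγ : Continuous γ := by
    apply Continuous.subtype_mk
    fun_prop
  have h1 : Tendsto (fun τ => Projectivization.mk ℝ (γ τ).1 (γ τ).2) (𝓝[>] 0)
      (𝓝 (atInfinity v hv)) := by
    have h2 := (continuous_mk.comp hγ).tendsto 0
    have h3 : γ 0 = ⟨(0, v), fun h' => hv (congrArg Prod.snd h')⟩ := by simp [γ]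
    simp only [Function.comp_apply, h3] at h2
    exact h2.mono_left nhdsWithin_le_nhds
  refine mem_closure_of_tendsto h1 ?_
  filter_upwards [self_mem_nhdsWithin] with τ hτ
  have hτ : 0 < τ := hτ
  refine ⟨p + τ⁻¹ • v, ?_, ?_⟩
  · rw [S.chamber]
    intro H
    rw [affine_add_smul]
    have := mul_nonneg (inv_pos.2 hτ).le (hr H)
    linarith [hp H]
  · rw [toProj, Projectivization.mk_eq_mk_iff']
    refine ⟨τ⁻¹, ?_⟩
    simp [γ, smul_smul, hτ.ne']

theorem atInfinity_mem_boundary_iff (S : IsBoundedSection A α F h C) {v : Space ℓ} (hv : v ≠ 0) :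
    atInfinity v hv ∈ boundaryAtInfinity C ↔
      (∀ H, 0 ≤ (α H).linear v) ∨ ∀ H, (α H).linear v ≤ 0 := by
  constructor
  · rintro ⟨hcl, -⟩
    let P : ℝ × Space ℓ → Prop := fun w =>
      (∀ H : A, True → 0 ≤ homogForm (α H) w) ∨ ∀ H : A, True → homogForm (α H) w ≤ 0
    have hP : ∀ (a : ℝ) (v : ℝ × Space ℓ), a ≠ 0 → (P (a • v) ↔ P v) := fun a v ha =>
      nonneg_or_nonpos_smul_iff a v ha
    have hPc : IsClosed {v | P v} := by
      simp only [P, true_imp_iff, ofPred_or, ofPred_forall]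
      exact (isClosed_iInter fun H => isClosed_le continuous_const (continuous_homogForm _)).union
        (isClosed_iInter fun H => isClosed_le (continuous_homogForm _) continuous_const)
    have hsub : toProj '' C ⊆ {p : ℙ ℝ (ℝ × Space ℓ) | P p.rep} := by
      rintro _ ⟨x, hx, rfl⟩
      rw [S.chamber] at hx
      refine (rep_mk_iff hP _).2 (Or.inl fun H _ => ?_)
      rw [homogForm_one]
      exact (hx H).le
    have := (rep_mk_iff hP _).1 (closure_minimal hsub (isClosed_setOf_rep hP hPc) hcl)
    simpa [P, homogForm_apply] using this
  · intro hr
    refine ⟨?_, v, hv, rfl⟩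
    rcases hr with hr | hr
    · exact S.atInfinity_mem_closure hv hr
    · rw [← atInfinity_neg hv]
      exact S.atInfinity_mem_closure (neg_ne_zero.2 hv) fun H => by simpa using hr H

theorem submodule_spanAtInfinity (S : IsBoundedSection A α F h C) :
    Projectivization.Subspace.submodule (spanAtInfinity C) =
      (parallelSpace α).map (LinearMap.inr ℝ ℝ (Space ℓ)) := by
  have := S.finite_index
  apply le_antisymm
  · rw [← Projectivization.Subspace.submodule.le_symm_apply, spanAtInfinity,
      Projectivization.Subspace.span_le_subspace_iff]
    rintro p hp
    obtain ⟨-, v, hv, rfl⟩ := id hp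
    refine (Submodule.mk_mem_projectivization_iff _ _).2 ⟨v, ?_, rfl⟩
    rcases (S.atInfinity_mem_boundary_iff hv).1 hp with hr | hr
    · exact recession_mem_parallelSpace hr
    · rw [← neg_neg v]
      exact neg_mem (recession_mem_parallelSpace fun H => by simpa using hr H)
  · rw [← span_recession_eq, Submodule.map_span, Submodule.span_le]
    rintro _ ⟨v, hv, rfl⟩
    rcases eq_or_ne v 0 with rfl | hne
    · exact Submodule.zero_mem _
    · have hne' : LinearMap.inr ℝ ℝ (Space ℓ) v ≠ 0 := by simpa using hne
      refine (Projectivization.Subspace.mem_submodule_iff _ hne').2 ?_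
      exact Projectivization.Subspace.subset_span _
        ((S.atInfinity_mem_boundary_iff hne).2 (Or.inl hv))

theorem finrank_parallelSpace (S : IsBoundedSection A α F h C) {d : ℕ}
    (hd : HasProjDim (spanAtInfinity C) d) : Module.finrank ℝ (parallelSpace α) = d + 1 := by
  rw [HasProjDim, S.submodule_spanAtInfinity] at hd
  rw [← hd]
  exact (Submodule.equivMapOfInjective _ LinearMap.inr_injective _).finrank_eq

theorem mk_mem_spanAtInfinity_iff (S : IsBoundedSection A α F h C) {w : ℝ × Space ℓ} (hw : w ≠ 0) :
    Projectivization.mk ℝ w hw ∈ spanAtInfinity C ↔ w.1 = 0 ∧ w.2 ∈ parallelSpace α := by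
  rw [← Projectivization.Subspace.mem_submodule_iff, S.submodule_spanAtInfinity]
  constructor
  · rintro ⟨v, hv, rfl⟩
    exact ⟨rfl, hv⟩
  · rintro ⟨h1, h2⟩
    exact ⟨w.2, h2, by ext1 <;> simp [h1]⟩

/-- Strict positivity of the non-parallel forms, up to a common sign, is an open condition, and the
parallel forms vanish on all of X(C). -/
theorem mem_relInterior (S : IsBoundedSection A α F h C) {v : Space ℓ} (hv : v ≠ 0)
    (hr : ∀ H, 0 ≤ (α H).linear v) (hrp : ∀ H, ¬ IsParallel α H → 0 < (α H).linear v) :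
    atInfinity v hv ∈ relInteriorAtInfinity C := by
  have := S.finite_index
  refine ⟨(S.atInfinity_mem_boundary_iff hv).2 (Or.inl hr), ?_⟩
  let P : ℝ × Space ℓ → Prop := fun w =>
    (∀ H : A, ¬ IsParallel α H → 0 < homogForm (α H) w) ∨
      ∀ H : A, ¬ IsParallel α H → homogForm (α H) w < 0
  have hP : ∀ (a : ℝ) (v : ℝ × Space ℓ), a ≠ 0 → (P (a • v) ↔ P v) := fun a v ha =>
    pos_or_neg_smul_iff a v ha
  have hPo : IsOpen {v | P v} := by
    simp only [P, ofPred_or, ofPred_forall]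
    exact (isOpen_iInter_of_finite fun H => isOpen_iInter_of_finite fun _ =>
      isOpen_lt continuous_const (continuous_homogForm _)).union
      (isOpen_iInter_of_finite fun H => isOpen_iInter_of_finite fun _ =>
        isOpen_lt (continuous_homogForm _) continuous_const)
  rw [mem_nhdsWithin]
  refine ⟨_, isOpen_setOf_rep hP hPo, ?_, ?_⟩
  · refine (rep_mk_iff hP _).2 (Or.inl fun H hH => ?_)
    simpa [homogForm_apply] using hrp H hH
  · rintro p ⟨hpP, hpX⟩
    induction p using Projectivization.ind with
    | h w hw =>
      have hwP := (rep_mk_iff hP hw).1 hpP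
      obtain ⟨h1, h2⟩ := (S.mk_mem_spanAtInfinity_iff hw).1 hpX
      obtain ⟨t, w⟩ := w
      simp only at h1 h2
      subst h1
      have hw0 : w ≠ 0 := fun h' => hw (by simp [h'])
      refine (S.atInfinity_mem_boundary_iff hw0).2 ?_
      refine hwP.imp (fun h3 H => ?_) (fun h3 H => ?_)
      · by_cases hH : IsParallel α H
        · rw [mem_parallelSpace.1 h2 H hH]
        · simpa [homogForm_apply] using (h3 H hH).le
      · by_cases hH : IsParallel α H
        · rw [mem_parallelSpace.1 h2 H hH]
        · simpa [homogForm_apply] using (h3 H hH).le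

/-- If α_H v = 0 and w is a recession direction with α_H w > 0, then v - s w stays in X(C) but has a
negative α_H for s > 0. Some α_K with α_K v > 0 stays positive for small s and excludes the opposite
representative as well. -/
theorem pos_of_mem_relInterior (S : IsBoundedSection A α F h C) {v : Space ℓ} (hv : v ≠ 0)
    (hr : ∀ H, 0 ≤ (α H).linear v) (hri : atInfinity v hv ∈ relInteriorAtInfinity C)
    {H : A} (hH : ¬ IsParallel α H) : 0 < (α H).linear v := by
  refine lt_of_le_of_ne (hr H) fun h0 => ?_
  obtain ⟨w, hw, hw0⟩ := not_forall₂.1 hH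
  have hwE : w ∈ parallelSpace α := recession_mem_parallelSpace hw
  have hvE : v ∈ parallelSpace α := recession_mem_parallelSpace hr
  obtain ⟨K, hK⟩ : ∃ K, 0 < (α K).linear v := by
    by_contra! hK
    exact hv (S.pointed v fun K => le_antisymm (hK K) (hr K))
  have hc : Continuous fun s : ℝ => v - s • w := by fun_prop
  have hne : ∀ᶠ s : ℝ in 𝓝 0, v - s • w ≠ 0 := by
    apply hc.continuousAt.eventually_ne
    simpa using hv
  let γ : ℝ → {v : ℝ × Space ℓ // v ≠ 0} := fun s =>
    if hs : v - s • w ≠ 0 then ⟨(0, v - s • w), fun h' => hs (congrArg Prod.snd h')⟩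
    else ⟨(0, v), fun h' => hv (congrArg Prod.snd h')⟩
  have hγ : Tendsto (fun s => Projectivization.mk ℝ (γ s).1 (γ s).2) (𝓝 0)
      (𝓝[(spanAtInfinity C : Set (ℙ ℝ (ℝ × Space ℓ)))] (atInfinity v hv)) := by
    rw [tendsto_nhdsWithin_iff]
    constructor
    · have h1 : ContinuousAt γ 0 := by
        refine tendsto_subtype_rng.2 ?_
        change ContinuousAt (fun s => (γ s).1) 0
        have h2 : (fun s => (γ s).1) =ᶠ[𝓝 0] fun s => ((0 : ℝ), v - s • w) := by
          filter_upwards [hne] with s hs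
          simp [γ, hs]
        refine ContinuousAt.congr (f := fun s => ((0 : ℝ), v - s • w)) ?_ h2.symm
        exact (continuous_const.prodMk hc).continuousAt
      have h3 : γ 0 = ⟨(0, v), fun h' => hv (congrArg Prod.snd h')⟩ := by simp [γ]
      have h4 := (continuous_mk.tendsto (γ 0)).comp h1
      rw [h3] at h4
      exact h4
    · filter_upwards [hne] with s hs
      refine (S.mk_mem_spanAtInfinity_iff _).2 ?_
      simp only [γ, hs, ne_eq, not_false_eq_true, dite_true, true_and]
      exact sub_mem hvE (Submodule.smul_mem _ _ hwE)
  have hb := hγ.eventually hri.2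
  have hKs : ∀ᶠ s : ℝ in 𝓝 0, 0 < (α K).linear (v - s • w) := by
    have h1 : Continuous fun s : ℝ => (α K).linear (v - s • w) :=
      (LinearMap.continuous_of_finiteDimensional _).comp hc
    exact h1.continuousAt.eventually (lt_mem_nhds (by simpa using hK))
  have hall := (hb.and (hKs.and hne)).filter_mono (nhdsWithin_le_nhds (s := Ioi (0 : ℝ)))
  obtain ⟨s, ⟨h1, h2, h3⟩, hs⟩ := (hall.and self_mem_nhdsWithin).exists
  have hs : 0 < s := hs
  have h4 : Projectivization.mk ℝ (γ s).1 (γ s).2 = atInfinity (v - s • w) h3 := by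
    simp [γ, h3, atInfinity]
  rw [h4] at h1
  rcases (S.atInfinity_mem_boundary_iff h3).1 h1 with h5 | h5
  · have h6 := h5 H
    rw [map_sub, map_smul, ← h0, smul_eq_mul, zero_sub] at h6
    have := mul_pos hs (lt_of_le_of_ne (hw H) (Ne.symm hw0))
    linarith
  · exact absurd (h5 K) (not_le.2 h2)

/-- A single line through a relatively interior point at infinity already determines D; conversely,
every admissible direction is strictly positive on the non-parallel functionals. -/
theorem isOpposite_iff (S : IsBoundedSection A α F h C) {D : Set (Space ℓ)} :
    IsOpposite A C D ↔ D = oppositeChamber α := by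
  have := S.finite_index
  constructor
  · rintro ⟨hD, hDC⟩
    obtain ⟨v, hv, hvp, hhv⟩ := S.exists_interior_recession
    have hne : v ≠ 0 := by rintro rfl; simp at hhv
    obtain ⟨p, hpC, -⟩ := S.section_nonempty
    have hp : ∀ H, 0 < α H p := by rw [S.chamber] at hpC; exact hpC
    have h1 := hDC p hpC v hne (S.mem_relInterior hne hv hvp) fun t ht => by
      rw [S.chamber]
      intro H
      rw [affine_add_smul]
      have := mul_nonneg ht (hv H)
      linarith [hp H]
    obtain ⟨t, ht1, ht2⟩ := (h1.and (eventually_mem_oppositeChamber hp hv hvp)).exists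
    rw [eq_of_mem_chambers S.mem_iff hD ht1, oppositeChamber_eq ht2]
  · rintro rfl
    refine ⟨S.oppositeChamber_mem_chambers, fun p hpC v hv hri hray => ?_⟩
    have hp : ∀ H, 0 < α H p := by rw [S.chamber] at hpC; exact hpC
    have hr : ∀ H, 0 ≤ (α H).linear v := by
      intro H
      by_contra! hneg
      have h1 := hray (α H p / -(α H).linear v) (div_nonneg (hp H).le (by linarith))
      rw [S.chamber] at h1
      have h2 := h1 H
      rw [affine_add_smul, div_neg, neg_mul, div_mul_cancel₀ _ hneg.ne, add_neg_cancel] at h2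
      exact lt_irrefl _ h2
    exact eventually_mem_oppositeChamber hp hr fun H hH => S.pos_of_mem_relInterior hv hr hri hH

end IsBoundedSection

/-! ### Directed fields on the section and their degree. -/

/-- Smooth selection from convex sets which locally contain a constant. -/
theorem exists_contDiff_forall_mem_convex {V : Type*} [NormedAddCommGroup V] [InnerProductSpace ℝ V]
    [FiniteDimensional ℝ V] {t : V → Set V} (ht : ∀ x, Convex ℝ (t x))
    (hloc : ∀ x, ∃ c, ∀ᶠ y in 𝓝 x, c ∈ t y) : ∃ g : V → V, ContDiff ℝ ∞ g ∧ ∀ x, g x ∈ t x := by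
  obtain ⟨g, hg⟩ := exists_contMDiffMap_forall_mem_convex_of_local_const (n := (⊤ : ℕ∞))
    (modelWithCornersSelf ℝ V) ht hloc
  exact ⟨g, g.contMDiff.contDiff, hg⟩

theorem pointEdges_finite {ℓ : ℕ} {A : Set (AffineSubspace ℝ (Space ℓ))} (hA : A.Finite)
    (F : AffineSubspace ℝ (Space ℓ)) : (pointEdges A F).Finite := by
  have h : pointEdges A F = ⋃ B ∈ {B | B ⊆ A},
      {p | (F : Set (Space ℓ)) ∩ (⋂ H ∈ B, (H : Set (Space ℓ))) = {p}} := by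
    ext p; simp [pointEdges]
  rw [h]
  refine hA.finite_subsets.biUnion fun B _ => Set.Subsingleton.finite ?_
  intro p hp q hq
  exact Set.singleton_injective (hp.symm.trans hq)

namespace IsBoundedSection

variable {ℓ : ℕ} {A : Set (AffineSubspace ℝ (Space ℓ))} {α : A → Space ℓ →ᵃ[ℝ] ℝ}
  {F : AffineSubspace ℝ (Space ℓ)} {h : Space ℓ →ᵃ[ℝ] ℝ} {C : Set (Space ℓ)}

theorem mem_section_direction_iff (S : IsBoundedSection A α F h C) {w : Space ℓ} :
    w ∈ F.direction ↔ h.linear w = 0 :=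
  mem_direction_iff S.mem_section (S.section_nonempty.mono inter_subset_right)

theorem apply_add_direction (S : IsBoundedSection A α F h C) {c : Space ℓ} (hc : c ∈ F)
    (v : F.direction) : h (c + v) = 0 := by
  rw [affine_add, (S.mem_section c).1 hc, S.mem_section_direction_iff.1 v.2, add_zero]

theorem mem_pointEdges (S : IsBoundedSection A α F h C) {y : Space ℓ} (hy : y ∈ F)
    (hv : ∀ w ∈ F.direction, (∀ H, α H y = 0 → (α H).linear w = 0) → w = 0) :
    y ∈ pointEdges A F := by
  refine ⟨{H | H ∈ A ∧ y ∈ H}, fun H hH => hH.1, ?_⟩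
  apply Subset.antisymm
  · rintro z ⟨hzF, hz⟩
    simp only [mem_iInter] at hz
    have h1 : z - y ∈ F.direction := AffineSubspace.vsub_mem_direction hzF hy
    have h2 := hv _ h1 fun H hH => by
      rw [affine_sub, hH, sub_zero]
      exact (S.mem_iff H z).1 (hz H.1 ⟨H.2, (S.mem_iff H y).2 hH⟩)
    exact sub_eq_zero.1 h2
  · rintro _ rfl
    refine ⟨hy, ?_⟩
    simp only [mem_iInter]
    exact fun H hH => hH.2

/-- Maximizing the inner product with v over the section polytope gives a vertex y with ‖v‖² ≤ ⟨v,
y⟩, and y lies in the ball. Thus the polytope misses the sphere, and the inward condition there is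
vacuous. -/
theorem norm_lt_of_mem_closure (S : IsBoundedSection A α F h C) {c : Space ℓ} (hc : c ∈ F) {R : ℝ}
    (hR : pointEdges A F ⊆ Metric.ball c R) {v : F.direction}
    (hv : c + (v : Space ℓ) ∈ closure C) : ‖v‖ < R := by
  have := S.finite_index
  rw [S.closure_chamber] at hv
  let β : A → F.direction →ᵃ[ℝ] ℝ := fun H =>
    (α H).comp (F.direction.subtype.toAffineMap + AffineMap.const ℝ F.direction c)
  have hβ : ∀ H v, β H v = α H (c + v) := fun H v => by simp [β, add_comm]
  have hβl : ∀ H v, (β H).linear v = (α H).linear v := fun H v => by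
    have h1 := affine_add (β H) 0 v
    rw [hβ, hβ, zero_add, Submodule.coe_zero, add_zero, affine_add] at h1
    linarith
  have hβpt : ∀ w, (∀ H, (β H).linear w = 0) → w = 0 := fun w hw => by
    have h1 := S.pointed w fun H => by rw [← hβl]; exact hw H
    simpa using h1
  rcases exists_ray_or_vertex (x := v) hβpt
    (innerSL ℝ v : F.direction →ₗ[ℝ] ℝ) (fun H => by rw [hβ]; exact hv H) with
    ⟨w, hw, hw0⟩ | ⟨y, hy, hvy, hyv⟩
  · have h0 : (w : Space ℓ) = 0 := S.eq_zero_of_recession_of_direction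
      (fun H => by rw [← hβl]; exact hw H) (S.mem_section_direction_iff.1 w.2)
    rw [Submodule.coe_eq_zero] at h0
    simp [h0] at hw0
  · have hyF : c + (y : Space ℓ) ∈ F := (S.mem_section _).2 (S.apply_add_direction hc y)
    have hye : c + (y : Space ℓ) ∈ pointEdges A F := S.mem_pointEdges hyF fun w hw hw0 => by
      have := hyv ⟨w, hw⟩ fun H hH => by
        rw [hβl]
        exact hw0 H (by rw [← hβ]; exact hH)
      simpa using this
    have h1 := hR hye
    rw [Metric.mem_ball, dist_self_add_left] at h1
    have h2 : ‖v‖ ^ 2 ≤ ‖v‖ * ‖y‖ := by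
      rw [← real_inner_self_eq_norm_sq]
      exact le_trans hvy (real_inner_le_norm v y)
    have h3 : ‖(y : Space ℓ)‖ = ‖y‖ := rfl
    rw [h3] at h1
    rcases (norm_nonneg v).eq_or_lt with h4 | h4
    · rw [← h4]
      exact (norm_nonneg y).trans_lt h1
    · rw [sq] at h2
      exact (le_of_mul_le_mul_left h2 h4).trans_lt h1

theorem continuous_affine (f : Space ℓ →ᵃ[ℝ] ℝ) : Continuous f :=
  AffineMap.continuous_of_finiteDimensional _

theorem eventually_active_subset (S : IsBoundedSection A α F h C) (c : Space ℓ)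
    (v : F.direction) :
    ∀ᶠ v' : F.direction in 𝓝 v, ∀ H, α H (c + v') = 0 → α H (c + v) = 0 := by
  have := S.finite_index
  rw [eventually_all]
  intro H
  by_cases h0 : α H (c + v) = 0
  · exact Eventually.of_forall fun _ _ => h0
  · have hc : Continuous fun v' : F.direction => α H (c + v') :=
      (continuous_affine _).comp (by fun_prop)
    filter_upwards [hc.continuousAt.eventually_ne h0] with v' h1 h2
    exact absurd h2 h1

theorem exists_active (S : IsBoundedSection A α F h C) {x : Space ℓ} (hx : x ∈ closure C)
    (hxC : x ∉ C) : ∃ H, α H x = 0 := by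
  rw [S.closure_chamber] at hx
  rw [S.chamber] at hxC
  obtain ⟨H, hH⟩ := not_forall.1 hxC
  exact ⟨H, le_antisymm (not_lt.1 hH) (hx H)⟩

theorem exists_isDirected (S : IsBoundedSection A α F h C) :
    ∃ (c : Space ℓ) (R : ℝ) (U : F.direction → F.direction),
      IsDirected A F C (oppositeChamber α) c R U := by
  obtain ⟨c, -, hc⟩ := S.section_nonempty
  obtain ⟨R, hR⟩ := (pointEdges_finite S.finite F).isBounded.subset_ball c
  obtain ⟨y, hy, hhy⟩ := S.exists_mem_oppositeChamber
  obtain ⟨U, hU, hUt⟩ := exists_contDiff_forall_mem_convex (V := F.direction)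
    (t := fun v => {e | ∀ H, α H (c + v) = 0 → (IsParallel α H → 0 < (α H).linear e) ∧
      (¬ IsParallel α H → (α H).linear e < 0)})
    (by
      rintro v e₁ h₁ e₂ h₂ a b ha hb hab H hH
      have h3 := h₁ H hH
      have h4 := h₂ H hH
      simp only [Submodule.coe_add, Submodule.coe_smul, map_add, map_smul, smul_eq_mul]
      refine ⟨fun hp => ?_, fun hp => ?_⟩
      · exact (convex_Ioi (0 : ℝ)) (h3.1 hp) (h4.1 hp) ha hb hab
      · exact (convex_Iio (0 : ℝ)) (h3.2 hp) (h4.2 hp) ha hb hab)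
    (by
      intro v
      obtain ⟨u, hu, huH⟩ := S.exists_face_ray (S.apply_add_direction hc v).ge
      -- The vector towards y ∈ D is not tangent to F. Correcting it by a multiple of the face ray u
      -- makes it tangent, and leaves its values on the active walls unchanged.
      have hmem : y - (c + v) + (-h y / h.linear u) • u ∈ F.direction := by
        rw [S.mem_section_direction_iff, map_add, affine_sub, S.apply_add_direction hc, map_smul,
          smul_eq_mul]
        field_simp
        ring
      refine ⟨⟨_, hmem⟩, ?_⟩
      filter_upwards [S.eventually_active_subset c v] with v' hv' H hH
      have hHv := hv' H hH
      have h1 : (α H).linear (y - (c + v) + (-h y / h.linear u) • u) = α H y := by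
        rw [map_add, affine_sub, map_smul, (huH H).1 hHv, hHv]; simp
      rw [h1]
      exact hy H)
  refine ⟨c, R, U, hc, hR, hU.continuous, fun v hv _ h0 => ?_, fun v hv hvC => ?_,
    fun H hH v hv z hz => ?_⟩
  · obtain ⟨H, hH⟩ := S.exists_active (isClosed_closure.frontier_subset hv) fun hvC =>
      hv.2 (interior_mono subset_closure (by rwa [S.isOpen_chamber.interior_eq]))
    have h1 := hUt v H hH
    rw [h0] at h1
    by_cases hp : IsParallel α H
    · simpa using h1.1 hp
    · simpa using h1.2 hp
  · exact absurd hv (S.norm_lt_of_mem_closure hc hR hvC).ne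
  · have hv0 : α ⟨H, hH⟩ (c + v) = 0 := (S.mem_iff ⟨H, hH⟩ _).1 hv
    rw [sSameSide_iff (S.mem_iff ⟨H, hH⟩) ⟨_, hv⟩, affine_add, hv0, zero_add]
    have h1 := hUt v ⟨H, hH⟩ hv0
    by_cases hp : IsParallel α ⟨H, hH⟩
    · exact mul_pos (h1.1 hp) ((hz _).1 hp)
    · exact mul_pos_of_neg_of_neg (h1.2 hp) ((hz _).2 hp)

theorem signs_of_isDirected (S : IsBoundedSection A α F h C) {c : Space ℓ} {R : ℝ}
    {U : F.direction → F.direction} (hU : IsDirected A F C (oppositeChamber α) c R U)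
    {v : F.direction} {H : A} (hH : α H (c + v) = 0) :
    (IsParallel α H → 0 < (α H).linear (U v)) ∧ (¬ IsParallel α H → (α H).linear (U v) < 0) := by
  obtain ⟨y, hy, -⟩ := S.exists_mem_oppositeChamber
  have hv := (S.mem_iff H _).2 hH
  have h1 := hU.directed H.1 H.2 v hv y hy
  rw [sSameSide_iff (S.mem_iff H) ⟨_, hv⟩, affine_add, hH, zero_add] at h1
  refine ⟨fun hp => ?_, fun hp => ?_⟩
  · exact (pos_iff_pos_of_mul_pos h1).2 ((hy H).1 hp)
  · have := (hy H).2 hp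
    by_contra! h2
    nlinarith

/-- A smooth field in the parallel directions which points strongly enough out of the section
polytope at its non-parallel faces. -/
theorem exists_parallel_field (S : IsBoundedSection A α F h C) {c : Space ℓ} (hc : c ∈ F)
    (b : A → ℝ) :
    ∃ e : F.direction → F.direction, ContDiff ℝ ∞ e ∧ ∀ v, (e v : Space ℓ) ∈ parallelSpace α ∧
      (c + (v : Space ℓ) ∈ closure C → ∀ H, ¬ IsParallel α H → α H (c + v) = 0 →
        (α H).linear (e v) < -b H) := by
  have := S.finite_index
  refine exists_contDiff_forall_mem_convex (V := F.direction)
    (t := fun v => {e | (e : Space ℓ) ∈ parallelSpace α ∧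
      (c + (v : Space ℓ) ∈ closure C → ∀ H, ¬ IsParallel α H → α H (c + v) = 0 →
        (α H).linear e < -b H)}) ?_ ?_
  · rintro v e₁ ⟨hE₁, h₁⟩ e₂ ⟨hE₂, h₂⟩ s t hs ht hst
    refine ⟨(parallelSpace α).convex hE₁ hE₂ hs ht hst, fun hv H hH hv0 => ?_⟩
    simp only [Submodule.coe_add, Submodule.coe_smul, map_add, map_smul]
    exact (convex_Iio (-b H)) (h₁ hv H hH hv0) (h₂ hv H hH hv0) hs ht hst
  · intro v
    by_cases hv : c + (v : Space ℓ) ∈ closure C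
    · obtain ⟨w, hw, hwp, hhw⟩ := S.exists_interior_recession
      obtain ⟨u, hu, huH⟩ := S.exists_face_ray (S.apply_add_direction hc v).ge
      have hur : ∀ H, 0 ≤ (α H).linear u := fun H => (huH H).2.1 (by
        rw [S.closure_chamber] at hv
        exact hv H)
      obtain ⟨t, ht⟩ := (exists_forall_pos_add_smul (fun H => (h.linear w)⁻¹ • (α H).linear)
        (fun H => -b H) (P := fun H => ¬ IsParallel α H) (v := w)
        (fun H hH => by
          have := hwp H hH
          rw [LinearMap.smul_apply, smul_eq_mul]
          positivity)).exists
      -- Both vectors are scaled to have h-slope 1, so their difference is tangent to F. On active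
      -- walls u contributes nothing, while -w is strictly outward at the non-parallel ones; t is
      -- chosen to beat `b`.
      let e : Space ℓ := t • ((h.linear u)⁻¹ • u - (h.linear w)⁻¹ • w)
      have he : e ∈ F.direction := by
        rw [S.mem_section_direction_iff]
        simp only [e, map_smul, map_sub, smul_eq_mul]
        rw [inv_mul_cancel₀ hu.ne', inv_mul_cancel₀ hhw.ne', sub_self, mul_zero]
      have heE : e ∈ parallelSpace α :=
        Submodule.smul_mem _ _ (sub_mem (Submodule.smul_mem _ _ (recession_mem_parallelSpace hur))
          (Submodule.smul_mem _ _ (recession_mem_parallelSpace hw)))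
      refine ⟨⟨e, he⟩, ?_⟩
      filter_upwards [S.eventually_active_subset c v] with v' hv'
      refine ⟨heE, fun _ H hH hv0 => ?_⟩
      have h1 := ht H hH
      rw [LinearMap.smul_apply, smul_eq_mul] at h1
      simp only [e, map_smul, map_sub, smul_eq_mul, (huH H).1 (hv' H hv0)]
      linarith
    · have hc' : Continuous fun v' : F.direction => c + (v' : Space ℓ) := by fun_prop
      refine ⟨0, ?_⟩
      filter_upwards [hc'.continuousAt.eventually (isClosed_closure.isOpen_compl.mem_nhds hv)]
        with v' hv'
      exact ⟨Submodule.zero_mem _, fun h' => absurd h' hv'⟩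

theorem isCompact_cell {F : AffineSubspace ℝ (Space ℓ)} (C : Set (Space ℓ)) (c : Space ℓ) (R : ℝ) :
    IsCompact (cell F C c R) := by
  have hc' : Continuous fun v : F.direction => c + (v : Space ℓ) := by fun_prop
  have : cell F C c R = Metric.closedBall 0 R ∩ (fun v : F.direction => c + (v : Space ℓ)) ⁻¹'
      closure C := by
    ext v
    simp only [cell, Set.mem_ofPred_eq, mem_inter_iff, mem_closedBall_zero_iff, mem_preimage]
    exact and_comm
  rw [this]
  exact (isCompact_closedBall _ _).inter_right (isClosed_closure.preimage hc')

theorem zero_notMem_segment_of_pos {V : Type*} [AddCommGroup V] [Module ℝ V] (l : V →ₗ[ℝ] ℝ)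
    {a b : V} (ha : 0 < l a) (hb : 0 < l b) : (0 : V) ∉ segment ℝ a b := by
  rintro ⟨s, t, hs, ht, hst, h⟩
  have h1 := (convex_Ioi (0 : ℝ)) ha hb hs ht hst
  have h2 := congrArg l h
  simp only [map_add, map_smul, map_zero] at h2
  rw [h2] at h1
  exact lt_irrefl (0 : ℝ) h1

theorem zero_notMem_segment_of_neg {V : Type*} [AddCommGroup V] [Module ℝ V] (l : V →ₗ[ℝ] ℝ)
    {a b : V} (ha : l a < 0) (hb : l b < 0) : (0 : V) ∉ segment ℝ a b :=
  zero_notMem_segment_of_pos (-l) (by simpa using ha) (by simpa using hb)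

theorem hasMappingDegree_of_isDirected (S : IsBoundedSection A α F h C) {c : Space ℓ} {R : ℝ}
    {U : F.direction → F.direction} (hU : IsDirected A F C (oppositeChamber α) c R U) :
    HasMappingDegree (cell F C c R) (gaussMap U)
      ((-1) ^ (Module.finrank ℝ F.direction -
        Module.finrank ℝ (F.direction ⊓ parallelSpace α : Submodule ℝ (Space ℓ)))) := by
  have hc := hU.center_mem
  have hcont : Continuous fun v : F.direction => c + (v : Space ℓ) := by fun_prop
  obtain ⟨o, hoC, hoF⟩ := S.section_nonempty
  let o' : F.direction := ⟨o - c, AffineSubspace.vsub_mem_direction hoF hc⟩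
  have ho' : c + (o' : Space ℓ) = o := by simp [o']
  have hint : o' ∈ interior (cell F C c R) := by
    have hopen : IsOpen (Metric.ball (0 : F.direction) R ∩
        (fun v : F.direction => c + (v : Space ℓ)) ⁻¹' C) :=
      Metric.isOpen_ball.inter (S.isOpen_chamber.preimage hcont)
    refine mem_interior.2 ⟨_, ?_, hopen, ?_, ?_⟩
    · rintro v ⟨h1, h2⟩
      exact ⟨subset_closure h2, (mem_ball_zero_iff.1 h1).le⟩
    · rw [mem_ball_zero_iff]
      exact S.norm_lt_of_mem_closure hc hU.pointEdges_subset
        (by rw [ho']; exact subset_closure hoC)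
    · rw [mem_preimage, ho']
      exact hoC
  have hfr : ∀ v ∈ frontier (cell F C c R), c + (v : Space ℓ) ∈ closure C ∧
      ∃ H, α H (c + v) = 0 := by
    intro v hv
    have h1 := (isCompact_cell C c R).isClosed.frontier_subset hv
    refine ⟨h1.1, S.exists_active h1.1 fun hvC => hv.2 ?_⟩
    have hopen : IsOpen (Metric.ball (0 : F.direction) R ∩
        (fun v : F.direction => c + (v : Space ℓ)) ⁻¹' C) :=
      Metric.isOpen_ball.inter (S.isOpen_chamber.preimage hcont)
    refine mem_interior.2 ⟨_, ?_, hopen, ?_, hvC⟩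
    · rintro v ⟨h1, h2⟩
      exact ⟨subset_closure h2, (mem_ball_zero_iff.1 h1).le⟩
    · rw [mem_ball_zero_iff]
      exact S.norm_lt_of_mem_closure hc hU.pointEdges_subset h1.1
  have hαo : ∀ H, 0 < α H o := by rw [S.chamber] at hoC; exact hoC
  have hU0 : ∀ v ∈ frontier (cell F C c R), U v ≠ 0 := by
    intro v hv h0
    obtain ⟨-, H, hH⟩ := hfr v hv
    have h1 := S.signs_of_isDirected hU hH
    rw [h0] at h1
    by_cases hp : IsParallel α H
    · simpa using h1.1 hp
    · simpa using h1.2 hp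
  -- The bound α_H(o) is the inward component of o - v at a wall, which e has to overcome where the
  -- wall is non-parallel.
  obtain ⟨e, he, heE⟩ := S.exists_parallel_field hc (fun H => α H o)
  let E : Submodule ℝ F.direction := (parallelSpace α).comap F.direction.subtype
  have hEd : Module.finrank ℝ Eᗮ = Module.finrank ℝ F.direction -
      Module.finrank ℝ (F.direction ⊓ parallelSpace α : Submodule ℝ (Space ℓ)) := by
    have h1 := E.finrank_add_finrank_orthogonal
    have h2 : Module.finrank ℝ E =
        Module.finrank ℝ (F.direction ⊓ parallelSpace α : Submodule ℝ (Space ℓ)) := by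
      rw [← Submodule.map_comap_subtype]
      exact (Submodule.equivMapOfInjective _ F.direction.injective_subtype _).finrank_eq
    omega
  let L : F.direction →L[ℝ] F.direction := (E.reflection.toContinuousLinearEquiv : _ →L[ℝ] _)
  have hLdet : L.det = (-1) ^ Module.finrank ℝ Eᗮ := E.det_reflection
  have hlin : ∀ (H : A) (v : F.direction), α H (c + v) = 0 →
      (α H).linear ((v - o' : F.direction) : Space ℓ) = -α H o := by
    intro H v hv
    have : ((v - o' : F.direction) : Space ℓ) = (c + v) - o := by
      rw [← ho']; simp
    rw [this, affine_sub, hv, zero_sub]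
  let l : A → F.direction →ₗ[ℝ] ℝ := fun H => (α H).linear ∘ₗ F.direction.subtype
  have hl : ∀ H v, l H v = (α H).linear v := fun H v => rfl
  have hG : ∀ (H : A) (v : F.direction), α H (c + v) = 0 →
      l H (-(v - o') + e v) = α H o + (α H).linear (e v) := by
    intro H v hv
    rw [map_add, map_neg, hl, hlin H v hv, neg_neg, hl]
  rw [← hEd]
  refine hasMappingDegree_of_homotopic_linear (o := o') (G := fun v => -(v - o') + e v) (L := L)
    (isCompact_cell C c R) hint (gaussMap_continuousOn hU.continuous.continuousOn hU0)
    (fun v hv => norm_gaussMap (hU0 v hv))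
    ((contDiff_id.sub contDiff_const).neg.add he)
    (by rw [hLdet, sign_neg_one_pow]) (by rw [hLdet]; positivity) ?_ ?_
  -- At one active wall, the Gauss map and G have components of the same strict sign.
  · intro v hv
    obtain ⟨hvC, H, hH⟩ := hfr v hv
    have hpos : 0 < ‖U v‖⁻¹ := inv_pos.2 (norm_pos_iff.2 (hU0 v hv))
    have h1 := S.signs_of_isDirected hU hH
    by_cases hp : IsParallel α H
    · refine zero_notMem_segment_of_pos (l H) ?_ ?_
      · rw [gaussMap, map_smul]
        exact mul_pos hpos (h1.1 hp)
      · rw [hG H v hH, mem_parallelSpace.1 (heE v).1 H hp, add_zero]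
        exact hαo H
    · refine zero_notMem_segment_of_neg (l H) ?_ ?_
      · rw [gaussMap, map_smul]
        exact mul_neg_of_pos_of_neg hpos (h1.2 hp)
      · rw [hG H v hH]
        have := (heE v).2 hvC H hp hH
        linarith
  · intro v hv h0
    obtain ⟨hvC, H, hH⟩ := hfr v hv
    have heE' : e v ∈ E := (heE v).1
    -- The reflection is twice the projection to E minus the identity, so a vanishing convex
    -- combination expresses v - o' through e v and a projection, both in E.
    have hvE : v - o' ∈ E := by
      obtain ⟨s, t, hs, ht, hst, h2⟩ := h0
      have hL : L (v - o') = (2 : ℝ) • (E.starProjection (v - o')) - (v - o') := by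
        rw [two_smul, ← two_nsmul]
        exact E.reflection_apply (v - o')
      have h3 : v - o' = s • e v + (2 * t) • E.starProjection (v - o') := by
        rw [hL] at h2
        have h4 : (s + t) • (v - o') = s • e v + (2 * t) • E.starProjection (v - o') := by
          rw [← sub_eq_zero, ← neg_eq_zero, ← h2]
          module
        rwa [hst, one_smul] at h4
      rw [h3]
      exact add_mem (E.smul_mem _ heE') (E.smul_mem _ (E.starProjection_apply_mem _))
    have hLv : L (v - o') = v - o' := E.reflection_mem_subspace_eq_self hvE
    -- An active parallel wall is excluded, since its functional vanishes on E but equals -α_H(o) at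
    -- v - o'.
    by_cases hp : IsParallel α H
    · have h1 := mem_parallelSpace.1 (show ((v - o' : F.direction) : Space ℓ) ∈ _ from hvE) H hp
      rw [hlin H v hH] at h1
      linarith [hαo H]
    · refine zero_notMem_segment_of_neg (l H) ?_ ?_ h0
      · rw [hG H v hH]
        have := (heE v).2 hvC H hp hH
        linarith
      · rw [hLv, hl, hlin H v hH]
        linarith [hαo H]

end IsBoundedSection

/-! ### Using the flag, and the proof of the theorem. -/

section Main

variable {ℓ : ℕ} {A : Set (AffineSubspace ℝ (Space ℓ))}

theorem IsArrangement.exists_equations (hA : IsArrangement A) {C : Set (Space ℓ)}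
    (hC : C ∈ chambers A) :
    ∃ α : A → Space ℓ →ᵃ[ℝ] ℝ, (∀ (H : A) (x : Space ℓ), x ∈ H.1 ↔ α H x = 0) ∧
      C = {x | ∀ H, 0 < α H x} := by
  classical
  have hex : ∀ H : A, ∃ f : Space ℓ →ᵃ[ℝ] ℝ, ∀ x, x ∈ H.1 ↔ f x = 0 := fun H =>
    exists_affine_of_hyperplane (hA.2 H.1 H.2).1 (by
      rw [finrank_euclideanSpace_fin]; exact (hA.2 H.1 H.2).2)
  choose f hf using hex
  obtain ⟨x, hx, rfl⟩ := hC
  let α : A → Space ℓ →ᵃ[ℝ] ℝ := fun H => if 0 < f H x then f H else -f H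
  have hα : ∀ (H : A) (x : Space ℓ), x ∈ H.1 ↔ α H x = 0 := by
    intro H y
    by_cases h : 0 < f H x <;> simp [α, h, hf]
  have hαx : ∀ H, 0 < α H x := by
    intro H
    by_cases h : 0 < f H x
    · simp [α, h]
    · have h1 : f H x ≠ 0 := fun h0 => hx H.1 H.2 ((hf H x).2 h0)
      have := lt_of_le_of_ne (not_lt.1 h) h1
      simpa [α, h] using this
  refine ⟨α, hα, ?_⟩
  rw [connectedComponentIn_compl hα hx]
  ext y
  exact forall_congr' fun H => mul_pos_iff_of_pos_left (hαx H)

theorem eq_zero_of_mem_pointEdges {α : A → Space ℓ →ᵃ[ℝ] ℝ}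
    (hα : ∀ (H : A) (x : Space ℓ), x ∈ H.1 ↔ α H x = 0) {B : Set (AffineSubspace ℝ (Space ℓ))}
    (hB : B ⊆ A) {p : Space ℓ}
    (hp : ((⊤ : AffineSubspace ℝ (Space ℓ)) : Set (Space ℓ)) ∩
      (⋂ H ∈ B, (H : Set (Space ℓ))) = {p}) {w : Space ℓ}
    (hw : ∀ (H : AffineSubspace ℝ (Space ℓ)) (hH : H ∈ B), (α ⟨H, hB hH⟩).linear w = 0) :
    w = 0 := by
  have hmem : p ∈ ((⊤ : AffineSubspace ℝ (Space ℓ)) : Set (Space ℓ)) ∩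
      (⋂ H ∈ B, (H : Set (Space ℓ))) := by rw [hp]; rfl
  have : p + w ∈ ((⊤ : AffineSubspace ℝ (Space ℓ)) : Set (Space ℓ)) ∩
      (⋂ H ∈ B, (H : Set (Space ℓ))) := by
    refine ⟨trivial, ?_⟩
    have h1 := hmem.2
    simp only [mem_iInter] at h1 ⊢
    intro H hH
    refine (hα ⟨H, hB hH⟩ _).2 ?_
    rw [affine_add, hw H hH, (hα ⟨H, hB hH⟩ _).1 (h1 H hH), add_zero]
  rw [hp] at this
  simpa using this

theorem mem_pointEdges_top {α : A → Space ℓ →ᵃ[ℝ] ℝ}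
    (hα : ∀ (H : A) (x : Space ℓ), x ∈ H.1 ↔ α H x = 0) {y : Space ℓ}
    (hy : ∀ w, (∀ H, α H y = 0 → (α H).linear w = 0) → w = 0) : y ∈ pointEdges A ⊤ := by
  refine ⟨{H | H ∈ A ∧ y ∈ H}, fun H hH => hH.1, ?_⟩
  apply Subset.antisymm
  · rintro z ⟨-, hz⟩
    simp only [mem_iInter] at hz
    refine sub_eq_zero.1 (hy (z - y) fun H hH => ?_)
    rw [affine_sub, hH, sub_zero]
    exact (hα H z).1 (hz H.1 ⟨H.2, (hα H y).2 hH⟩)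
  · rintro _ rfl
    refine ⟨trivial, ?_⟩
    simp only [mem_iInter]
    exact fun H hH => hH.2

theorem IsGenericFlag.eq_top {F : ℕ → AffineSubspace ℝ (Space ℓ)} (hF : IsGenericFlag A F) :
    F ℓ = ⊤ := by
  rw [← AffineSubspace.direction_eq_top_iff_of_nonempty (hF.nonempty ℓ le_rfl)]
  apply Submodule.eq_top_of_finrank_eq
  rw [hF.finrank_direction ℓ le_rfl, finrank_euclideanSpace_fin]

/-- The vertices of the arrangement do not lie on the generic hyperplane of the flag. -/
theorem IsGenericFlag.notMem_of_mem_pointEdges {m : ℕ}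
    {A : Set (AffineSubspace ℝ (Space (m + 1)))} {F : ℕ → AffineSubspace ℝ (Space (m + 1))}
    (hF : IsGenericFlag A F) {α : A → Space (m + 1) →ᵃ[ℝ] ℝ}
    (hα : ∀ (H : A) (x : Space (m + 1)), x ∈ H.1 ↔ α H x = 0)
    (hne : ∀ H : A, (H.1 : Set (Space (m + 1))).Nonempty) {y : Space (m + 1)}
    (hy : y ∈ pointEdges A ⊤) : y ∉ F m := by
  intro hyF
  obtain ⟨B, hB, hBy⟩ := id hy
  have hyB : ∀ H ∈ B, y ∈ H := by
    have : y ∈ ((⊤ : AffineSubspace ℝ (Space (m + 1))) : Set (Space (m + 1))) ∩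
      (⋂ H ∈ B, (H : Set (Space (m + 1)))) := by rw [hBy]; rfl
    simpa using this.2
  set X : Submodule ℝ (ℝ × Space (m + 1)) := sInf (homogenize '' B) with hX
  have hXm : X ∈ projEdges A :=
    ⟨homogenize '' B, (image_mono hB).trans (subset_insert _ _), rfl⟩
  have hXs : X = Submodule.span ℝ {((1 : ℝ), y)} := by
    apply le_antisymm
    · rintro ⟨t, u⟩ hw
      rw [hX, Submodule.mem_sInf] at hw
      have h1 : u - t • y = 0 := eq_zero_of_mem_pointEdges hα hB hBy fun H hH => by
        have h2 := (mem_homogenize_iff (hα ⟨H, hB hH⟩) (hne ⟨H, hB hH⟩)).1 (hw _ ⟨H, hH, rfl⟩)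
        have h3 := (hα ⟨H, hB hH⟩ y).1 (hyB H hH)
        rw [affine_eq_linear_add] at h3
        simp only at h2
        rw [map_sub, map_smul, smul_eq_mul]
        linear_combination h2 - t * h3
      exact Submodule.mem_span_singleton.2 ⟨t, by simp [sub_eq_zero.1 h1]⟩
    · rw [Submodule.span_singleton_le_iff_mem, hX, Submodule.mem_sInf]
      rintro _ ⟨H, hH, rfl⟩
      exact Submodule.subset_span ⟨y, hyB H hH, rfl⟩
  have hv : ((1 : ℝ), y) ≠ 0 := fun h => one_ne_zero (congrArg Prod.fst h)
  have h1 : Module.finrank ℝ X = 1 := by rw [hXs]; exact finrank_span_singleton hv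
  have h2 := hF.generic m (Nat.le_succ m) X hXm
  -- A vertex has linear dimension 1, so a generic hyperplane must miss it.
  rw [h1, show 1 + m - (m + 1) = 0 by omega, Submodule.finrank_eq_zero] at h2
  have h3 : ((1 : ℝ), y) ∈ X ⊓ homogenize (F m) :=
    ⟨by rw [hXs]; exact Submodule.mem_span_singleton_self _, Submodule.subset_span ⟨y, hyF, rfl⟩⟩
  rw [h2] at h3
  exact hv h3

theorem exists_isBoundedSection {m : ℕ} {A : Set (AffineSubspace ℝ (Space (m + 1)))}
    (hA : IsArrangement A) (hess : IsEssential A) {F : ℕ → AffineSubspace ℝ (Space (m + 1))}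
    (hF : IsGenericFlag A F) (hnear : IsNearInfinity A F) {C : Set (Space (m + 1))}
    (hC : C ∈ bch A F m) : ∃ α h, IsBoundedSection A α (F m) h C := by
  obtain ⟨α, hα, hCα⟩ := hA.exists_equations hC.1.1
  have hne : ∀ H : A, (H.1 : Set (Space (m + 1))).Nonempty := fun H => (hA.2 H.1 H.2).1
  have hFne := hF.nonempty m (Nat.le_succ m)
  obtain ⟨f, hf⟩ := exists_affine_of_hyperplane hFne (by
    rw [finrank_euclideanSpace_fin, hF.finrank_direction m (Nat.le_succ m)])
  have hf0 : ∀ y ∈ pointEdges A ⊤, f y ≠ 0 := fun y hy h0 =>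
    hF.notMem_of_mem_pointEdges hα hne hy ((hf y).2 h0)
  have hff : ∀ y ∈ pointEdges A ⊤, ∀ z ∈ pointEdges A ⊤, 0 < f y * f z := by
    intro y hy z hz
    by_contra! hle
    have hlt := lt_of_le_of_ne hle (mul_ne_zero (hf0 y hy) (hf0 z hz))
    rw [← hF.eq_top] at hy hz
    exact hnear m (Nat.lt_succ_self m) y hy z hz (sOppSide_of_mul_neg hf hFne hlt)
  obtain ⟨p, hp⟩ := hess
  have hpt : ∀ w, (∀ H, (α H).linear w = 0) → w = 0 := by
    obtain ⟨B, hB, hBp⟩ := id hp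
    exact fun w hw => eq_zero_of_mem_pointEdges hα hB hBp fun H hH => hw _
  obtain ⟨h, hh, hhn⟩ : ∃ h : Space (m + 1) →ᵃ[ℝ] ℝ, (∀ x, x ∈ F m ↔ h x = 0) ∧
      ∀ y ∈ pointEdges A ⊤, h y < 0 := by
    rcases (hf0 p hp).lt_or_gt with h0 | h0
    · refine ⟨f, hf, fun y hy => ?_⟩
      have := hff p hp y hy
      by_contra! h1
      nlinarith
    · refine ⟨-f, fun x => by simp [hf], fun y hy => ?_⟩
      have := (pos_iff_pos_of_mul_pos (hff p hp y hy)).1 h0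
      simpa using this
  exact ⟨α, h, hA.1, hne, hα, hpt, hh, fun y hy => hhn y (mem_pointEdges_top hα hy), hCα,
    hC.1.2.1, hC.2⟩

/-- X(C) is itself an edge of the projective closure: the intersection of the hyperplane at infinity
with the closures of the parallel walls. Genericity therefore lowers its linear dimension d + 1 by
one when it is cut with F. -/
theorem IsBoundedSection.finrank_direction_inf {m : ℕ}
    {A : Set (AffineSubspace ℝ (Space (m + 1)))} {F : ℕ → AffineSubspace ℝ (Space (m + 1))}
    {C : Set (Space (m + 1))} {α : A → Space (m + 1) →ᵃ[ℝ] ℝ} {h : Space (m + 1) →ᵃ[ℝ] ℝ}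
    (S : IsBoundedSection A α (F m) h C) (hF : IsGenericFlag A F) {d : ℕ}
    (hd : HasProjDim (spanAtInfinity C) d) :
    Module.finrank ℝ ((F m).direction ⊓ parallelSpace α : Submodule ℝ (Space (m + 1))) = d := by
  set X : Submodule ℝ (ℝ × Space (m + 1)) :=
    sInf (insert (infinityHyperplane (m + 1))
      (homogenize '' {H | ∃ hH : H ∈ A, IsParallel α ⟨H, hH⟩}))
    with hX
  have hXm : X ∈ projEdges A :=
    ⟨_, insert_subset_insert (image_mono fun H hH => hH.1), rfl⟩
  have hXs : X = (parallelSpace α).map (LinearMap.inr ℝ ℝ _) := by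
    ext ⟨t, w⟩
    rw [hX, sInf_insert, Submodule.mem_inf, Submodule.mem_sInf]
    have hinf : ((t, w) : ℝ × Space (m + 1)) ∈ infinityHyperplane (m + 1) ↔ t = 0 := Iff.rfl
    rw [hinf]
    constructor
    · rintro ⟨rfl, hw⟩
      refine ⟨w, mem_parallelSpace.2 fun H hH => ?_, rfl⟩
      have := (mem_homogenize_iff (S.mem_iff H) (S.nonempty H)).1
        (hw _ ⟨H.1, ⟨H.2, hH⟩, rfl⟩)
      simpa using this
    · rintro ⟨v, hv, hvw⟩
      obtain ⟨rfl, rfl⟩ := Prod.mk.inj hvw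
      refine ⟨rfl, ?_⟩
      rintro _ ⟨H, ⟨hH, hp⟩, rfl⟩
      rw [mem_homogenize_iff (S.mem_iff ⟨H, hH⟩) (S.nonempty ⟨H, hH⟩)]
      simpa using mem_parallelSpace.1 hv ⟨H, hH⟩ hp
  have hinj : Function.Injective (LinearMap.inr ℝ ℝ (Space (m + 1))) := LinearMap.inr_injective
  have h1 : Module.finrank ℝ X = d + 1 := by
    rw [hXs, ← S.finrank_parallelSpace hd]
    exact (Submodule.equivMapOfInjective _ hinj _).symm.finrank_eq
  have h2 : X ⊓ homogenize (F m) =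
      ((F m).direction ⊓ parallelSpace α).map (LinearMap.inr ℝ ℝ _) := by
    rw [hXs]
    have hFm : ∀ v, ((0 : ℝ), v) ∈ homogenize (F m) ↔ v ∈ (F m).direction := by
      intro v
      rw [mem_homogenize_iff S.mem_section (S.section_nonempty.mono inter_subset_right),
        S.mem_section_direction_iff]
      simp
    ext w
    constructor
    · rintro ⟨⟨v, hv, rfl⟩, hw⟩
      exact ⟨v, ⟨(hFm v).1 hw, hv⟩, rfl⟩
    · rintro ⟨v, ⟨hvF, hv⟩, rfl⟩
      exact ⟨⟨v, hv, rfl⟩, (hFm v).2 hvF⟩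
  have h3 := hF.generic m (Nat.le_succ m) X hXm
  rw [h1, h2, show d + 1 + m - (m + 1) = d by omega] at h3
  rw [← h3]
  exact (Submodule.equivMapOfInjective _ hinj _).finrank_eq

end Main

end Arrangement

theorem theorem4p5 (ℓ : ℕ) (hℓ : 1 ≤ ℓ)
    (A : Set (AffineSubspace ℝ (Arrangement.Space ℓ)))
    (hA : Arrangement.IsArrangement A) (hess : Arrangement.IsEssential A)
    (F : ℕ → AffineSubspace ℝ (Arrangement.Space ℓ))
    (hF : Arrangement.IsGenericFlag A F) (hnear : Arrangement.IsNearInfinity A F)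
    (C : Set (Arrangement.Space ℓ)) (hC : C ∈ Arrangement.bch A F (ℓ - 1))
    (d : ℕ) (hd : Arrangement.HasProjDim (Arrangement.spanAtInfinity C) d) :
    (∃! D : Set (Arrangement.Space ℓ), Arrangement.IsOpposite A C D) ∧
      (∀ D : Set (Arrangement.Space ℓ), Arrangement.IsOpposite A C D →
        D ∈ Arrangement.ch A F ℓ ∧
          Arrangement.IsDegree A (F (ℓ - 1)) C D ((-1) ^ (ℓ - 1 - d))) ∧
      Arrangement.HasIndexAtOrigin (Arrangement.linearField (ℓ - 1) d)
        ((-1) ^ (ℓ - 1 - d)) := by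
  obtain ⟨m, rfl⟩ : ∃ m, ℓ = m + 1 := ⟨ℓ - 1, by omega⟩
  rw [Nat.add_sub_cancel] at hC ⊢
  obtain ⟨α, h, S⟩ := Arrangement.exists_isBoundedSection hA hess hF hnear hC
  refine ⟨⟨Arrangement.oppositeChamber α, S.isOpposite_iff.2 rfl,
      fun D hD => S.isOpposite_iff.1 hD⟩,
    fun D hD => ?_, Arrangement.hasIndexAtOrigin_linearField m d⟩
  obtain rfl := S.isOpposite_iff.1 hD
  obtain ⟨y, hy, -⟩ := S.exists_mem_oppositeChamber
  refine ⟨⟨S.oppositeChamber_mem_chambers, ⟨y, hy, ?_⟩, S.oppositeChamber_disjoint⟩,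
    S.exists_isDirected, fun c R U hU => ?_⟩
  · rw [hF.eq_top]
    trivial
  · have hdeg := S.hasMappingDegree_of_isDirected hU
    rwa [hF.finrank_direction m (Nat.le_succ m), S.finrank_direction_inf hF hd] at hdeg
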